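/- An input-driven pushdown automaton with translucent letters is a system $M=\langle Q,\Sigma,\Gamma,q_0,\triangleleft,\bot,\tau,\delta_D,\delta_R,\delta_N\rangle$ with finite sets $Q$ of states, $\Sigma$ of input letters and $\Gamma$ of pushdown symbols, an initial state $q_0\in Q$, an endmarker $\triangleleft\notin\Sigma$, a bottom symbol $\bot\notin\Gamma$, a partition $\Sigma=\Sigma_D\cup\Sigma_R\cup\Sigma_N$, a translucency mapping $\tau:Q\to 2^\Sigma$, and partial functions $\delta_D:Q\times\Sigma_D\times(\Gamma\cup\{\bot\})\to 2^{Q\times\Gamma}\cup\{\mathtt{accept}\}$, $\delta_R:Q\times\Sigma_R\times(\Gamma\cup\{\bot\})\to 2^{Q}\cup\{\mathtt{accept}\}$, $\delta_N:Q\times(\Sigma_N\cup\{\triangleleft\})\times(\Gamma\cup\{\bot\})\to 2^{Q}\cup\{\mathtt{accept}\}$. It starts in state $q_0$ at the left end of the input, with pushdown content $\bot$. In each step, in state $q$ with topmost pushdown symbol $z$, it scans the first symbol $c\notin\tau(q)$ to the right of the head (possibly $\triangleleft$) and applies $\delta_D$, $\delta_R$ or $\delta_N$, according to the class of $c$, to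 $(q,c,z)$. If the value is $\mathtt{accept}$, the input is accepted. Otherwise $M$ nondeterministically chooses an element of the value (and halts without accepting if there is none): it enters the chosen state and, for $\delta_D$, pushes the chosen symbol, for $\delta_R$, pops the topmost symbol (but $\bot$ is never removed), and for $\delta_N$, leaves the pushdown unchanged; if $c\neq\triangleleft$, then $c$ is deleted from the input. In the returning mode ($\mathsf{NIDPDAwtl}$) the head is then placed at the left end of the remaining input. In the non-returning mode ($\mathsf{nrNIDPDAwtl}$) the head continues from the position of the deleted letter, and it is placed at the left end of the remaining input only after a step on $\triangleleft$. The language accepted by $M$ is the set of all $w\in\Sigma^*$ on which some computation of $M$ accepts, and $\mathscr{L}(\mathsf{X})$ denotes the family of all languages accepted by automata of type $\mathsf{X}$. **Theorem.** Over the alphabet $\{a,b,\#\}$ let $$L_{rep}=\bigcup_{n\ge 1,\ k\ge 0} \bigl(\{b^n(\#b^n)^k\}\mathbin{\sqcup\!\sqcup}\{a^n\}\bigr),$$ where the shuffle $L_1\mathbin{\sqcup\!\sqcup} L_2$ is the set of all words $x_1y_1x_2y_2\cdots x_my_m$ with words $x_i,y_i$ such that $x_1x_2\cdots x_m\in L_1$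 and $y_1y_2\cdots y_m\in L_2$. Then the complement $\{a,b,\#\}^*\setminus L_{rep}$ belongs to both $\mathscr{L}(\mathsf{NIDPDAwtl})$ and $\mathscr{L}(\mathsf{nrNIDPDAwtl})$, while $L_{rep}$ belongs to neither of the two families. Consequently, neither $\mathscr{L}(\mathsf{nrNIDPDAwtl})$ nor $\mathscr{L}(\mathsf{NIDPDAwtl})$ is closed under complementation. -/

import Mathlib

namespace TransPDA

/-- The three classes of a signature: letters that push (`Σ_D`), letters that pop (`Σ_R`),
letters that leave the pushdown store unchanged (`Σ_N`). -/
inductive Action where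
  | push
  | pop
  | neutral

/-- A value of a partial transition function into `2^X ∪ {accept}`. -/
inductive Outcome (X : Type) where
  | undefined
  | moves (S : Set X)
  | accept

/-- A nondeterministic input-driven pushdown automaton with translucent input letters, with
input alphabet `A`, states `Q` and pushdown symbols `G`. The partition of `A` is the map `sig`.
A pushdown top in `G ∪ {⊥}` is an `Option G`, with `none` for the bottom symbol `⊥`; in `δN`,
the letter `none` is the endmarker. -/
structure PDA (A Q G : Type) where
  sig : A → Action
  q₀ : Q
  τ : Q → Set A
  δD : Q → {a : A // sig a = Action.push} → Option G → Outcome (Q × G)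
  δR : Q → {a : A // sig a = Action.pop} → Option G → Outcome Q
  δN : Q → Option {a : A // sig a = Action.neutral} → Option G → Outcome Q

/-- Configurations in the returning mode: state, remaining input (the endmarker is implicit),
and pushdown content, top first (the bottom symbol is implicit); or `accept`. -/
inductive RConf (A Q G : Type) where
  | conf (q : Q) (w : List A) (γ : List G)
  | accept

/-- Configurations in the non-returning mode: remaining input to the left of the head, state,
remaining input to the right of the head, and pushdown content; or `accept`. -/
inductive NRConf (A Q G : Type) where
  | conf (u : List A) (q : Q) (w : List A) (γ : List G)
  | accept

namespace PDA

variable {A Q G : Type}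

/-- One step in the returning mode. The scanned symbol is the first one that is not translucent
for the current state; a letter is deleted when processed, the endmarker is not. `γ.head?` is
the top of the pushdown store, or `none` (that is `⊥`) if the store is empty, and `γ.tail` leaves
the empty store empty. -/
inductive RStep (M : PDA A Q G) : RConf A Q G → RConf A Q G → Prop
  | push (q q' : Q) (x y : List A) (a : A) (γ : List G) (z' : G) (S : Set (Q × G))
      (hx : ∀ c ∈ x, c ∈ M.τ q) (ha : a ∉ M.τ q) (h : M.sig a = Action.push)
      (hδ : M.δD q ⟨a, h⟩ γ.head? = Outcome.moves S) (hS : (q', z') ∈ S) :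
      RStep M (RConf.conf q (x ++ a :: y) γ) (RConf.conf q' (x ++ y) (z' :: γ))
  | pop (q q' : Q) (x y : List A) (a : A) (γ : List G) (S : Set Q)
      (hx : ∀ c ∈ x, c ∈ M.τ q) (ha : a ∉ M.τ q) (h : M.sig a = Action.pop)
      (hδ : M.δR q ⟨a, h⟩ γ.head? = Outcome.moves S) (hS : q' ∈ S) :
      RStep M (RConf.conf q (x ++ a :: y) γ) (RConf.conf q' (x ++ y) γ.tail)
  | neutral (q q' : Q) (x y : List A) (a : A) (γ : List G) (S : Set Q)
      (hx : ∀ c ∈ x, c ∈ M.τ q) (ha : a ∉ M.τ q) (h : M.sig a = Action.neutral)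
      (hδ : M.δN q (some ⟨a, h⟩) γ.head? = Outcome.moves S) (hS : q' ∈ S) :
      RStep M (RConf.conf q (x ++ a :: y) γ) (RConf.conf q' (x ++ y) γ)
  | endmarker (q q' : Q) (x : List A) (γ : List G) (S : Set Q)
      (hx : ∀ c ∈ x, c ∈ M.τ q)
      (hδ : M.δN q none γ.head? = Outcome.moves S) (hS : q' ∈ S) :
      RStep M (RConf.conf q x γ) (RConf.conf q' x γ)
  | acceptPush (q : Q) (x y : List A) (a : A) (γ : List G)
      (hx : ∀ c ∈ x, c ∈ M.τ q) (ha : a ∉ M.τ q) (h : M.sig a = Action.push)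
      (hδ : M.δD q ⟨a, h⟩ γ.head? = Outcome.accept) :
      RStep M (RConf.conf q (x ++ a :: y) γ) RConf.accept
  | acceptPop (q : Q) (x y : List A) (a : A) (γ : List G)
      (hx : ∀ c ∈ x, c ∈ M.τ q) (ha : a ∉ M.τ q) (h : M.sig a = Action.pop)
      (hδ : M.δR q ⟨a, h⟩ γ.head? = Outcome.accept) :
      RStep M (RConf.conf q (x ++ a :: y) γ) RConf.accept
  | acceptNeutral (q : Q) (x y : List A) (a : A) (γ : List G)
      (hx : ∀ c ∈ x, c ∈ M.τ q) (ha : a ∉ M.τ q) (h : M.sig a = Action.neutral)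
      (hδ : M.δN q (some ⟨a, h⟩) γ.head? = Outcome.accept) :
      RStep M (RConf.conf q (x ++ a :: y) γ) RConf.accept
  | acceptEndmarker (q : Q) (x : List A) (γ : List G)
      (hx : ∀ c ∈ x, c ∈ M.τ q)
      (hδ : M.δN q none γ.head? = Outcome.accept) :
      RStep M (RConf.conf q x γ) RConf.accept

/-- One step in the non-returning mode: after a letter is processed the head stays at its
position; after the endmarker is processed the head returns to the left end. -/
inductive NRStep (M : PDA A Q G) : NRConf A Q G → NRConf A Q G → Prop
  | push (u : List A) (q q' : Q) (x y : List A) (a : A) (γ : List G) (z' : G) (S : Set (Q × G))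
      (hx : ∀ c ∈ x, c ∈ M.τ q) (ha : a ∉ M.τ q) (h : M.sig a = Action.push)
      (hδ : M.δD q ⟨a, h⟩ γ.head? = Outcome.moves S) (hS : (q', z') ∈ S) :
      NRStep M (NRConf.conf u q (x ++ a :: y) γ) (NRConf.conf (u ++ x) q' y (z' :: γ))
  | pop (u : List A) (q q' : Q) (x y : List A) (a : A) (γ : List G) (S : Set Q)
      (hx : ∀ c ∈ x, c ∈ M.τ q) (ha : a ∉ M.τ q) (h : M.sig a = Action.pop)
      (hδ : M.δR q ⟨a, h⟩ γ.head? = Outcome.moves S) (hS : q' ∈ S) :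
      NRStep M (NRConf.conf u q (x ++ a :: y) γ) (NRConf.conf (u ++ x) q' y γ.tail)
  | neutral (u : List A) (q q' : Q) (x y : List A) (a : A) (γ : List G) (S : Set Q)
      (hx : ∀ c ∈ x, c ∈ M.τ q) (ha : a ∉ M.τ q) (h : M.sig a = Action.neutral)
      (hδ : M.δN q (some ⟨a, h⟩) γ.head? = Outcome.moves S) (hS : q' ∈ S) :
      NRStep M (NRConf.conf u q (x ++ a :: y) γ) (NRConf.conf (u ++ x) q' y γ)
  | endmarker (u : List A) (q q' : Q) (x : List A) (γ : List G) (S : Set Q)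
      (hx : ∀ c ∈ x, c ∈ M.τ q)
      (hδ : M.δN q none γ.head? = Outcome.moves S) (hS : q' ∈ S) :
      NRStep M (NRConf.conf u q x γ) (NRConf.conf [] q' (u ++ x) γ)
  | acceptPush (u : List A) (q : Q) (x y : List A) (a : A) (γ : List G)
      (hx : ∀ c ∈ x, c ∈ M.τ q) (ha : a ∉ M.τ q) (h : M.sig a = Action.push)
      (hδ : M.δD q ⟨a, h⟩ γ.head? = Outcome.accept) :
      NRStep M (NRConf.conf u q (x ++ a :: y) γ) NRConf.accept
  | acceptPop (u : List A) (q : Q) (x y : List A) (a : A) (γ : List G)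
      (hx : ∀ c ∈ x, c ∈ M.τ q) (ha : a ∉ M.τ q) (h : M.sig a = Action.pop)
      (hδ : M.δR q ⟨a, h⟩ γ.head? = Outcome.accept) :
      NRStep M (NRConf.conf u q (x ++ a :: y) γ) NRConf.accept
  | acceptNeutral (u : List A) (q : Q) (x y : List A) (a : A) (γ : List G)
      (hx : ∀ c ∈ x, c ∈ M.τ q) (ha : a ∉ M.τ q) (h : M.sig a = Action.neutral)
      (hδ : M.δN q (some ⟨a, h⟩) γ.head? = Outcome.accept) :
      NRStep M (NRConf.conf u q (x ++ a :: y) γ) NRConf.accept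
  | acceptEndmarker (u : List A) (q : Q) (x : List A) (γ : List G)
      (hx : ∀ c ∈ x, c ∈ M.τ q)
      (hδ : M.δN q none γ.head? = Outcome.accept) :
      NRStep M (NRConf.conf u q x γ) NRConf.accept

/-- The language accepted in the returning mode. -/
def retLanguage (M : PDA A Q G) : Language A :=
  {w | Relation.ReflTransGen M.RStep (RConf.conf M.q₀ w []) RConf.accept}

/-- The language accepted in the non-returning mode. -/
def nonretLanguage (M : PDA A Q G) : Language A :=
  {w | Relation.ReflTransGen M.NRStep (NRConf.conf [] M.q₀ w []) NRConf.accept}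

end PDA

/-- The languages over the alphabet `A` in the family `ℒ(NIDPDAwtl)`. -/
def NIDPDAwtl (A : Type) : Set (Language A) :=
  {L | ∃ (Q G : Type) (_ : Finite Q) (_ : Finite G) (M : PDA A Q G), M.retLanguage = L}

/-- The languages over the alphabet `A` in the family `ℒ(nrNIDPDAwtl)`. -/
def NrNIDPDAwtl (A : Type) : Set (Language A) :=
  {L | ∃ (Q G : Type) (_ : Finite Q) (_ : Finite G) (M : PDA A Q G), M.nonretLanguage = L}

/-- A family of languages over finite alphabets is closed under complementation. -/
def ClosedUnderComplement (F : (A : Type) → Set (Language A)) : Prop :=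
  ∀ (A : Type) [Finite A] (L : Language A), L ∈ F A → Lᶜ ∈ F A

/-- The shuffle: all words `x₁y₁x₂y₂⋯xₘyₘ` with `x₁x₂⋯xₘ ∈ L₁` and `y₁y₂⋯yₘ ∈ L₂`; the list `p`
consists of the pairs `(xᵢ, yᵢ)`. -/
def shuffle {A : Type} (L₁ L₂ : Language A) : Language A :=
  {w | ∃ p : List (List A × List A), (p.map Prod.fst).flatten ∈ L₁ ∧
    (p.map Prod.snd).flatten ∈ L₂ ∧ w = (p.map fun xy => xy.1 ++ xy.2).flatten}

/-- The alphabet `{a, b, #}`. -/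
inductive Letter where
  | a
  | b
  | hash
  deriving DecidableEq

instance : Fintype Letter where
  elems := {Letter.a, Letter.b, Letter.hash}
  complete x := by cases x <;> decide

/-- The word `bⁿ(#bⁿ)ᵏ`. -/
def repWord (n k : ℕ) : List Letter :=
  List.replicate n Letter.b ++
    (List.replicate k (Letter.hash :: List.replicate n Letter.b)).flatten

/-- The union over `n ≥ 1` and `k ≥ 0` of the shuffles of `bⁿ(#bⁿ)ᵏ` with `aⁿ`. -/
def Lrep : Language Letter :=
  {w | ∃ n k : ℕ, 1 ≤ n ∧ w ∈ shuffle {repWord n k} {List.replicate n Letter.a}}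

end TransPDA

/-! For the complement, one automaton serves both modes. A word with at least one `a` lies outside
`Lrep` exactly when, after erasing `a`, some maximal block of letters `b` has a length different
from the number of letters `a` (`eq_repWord_or_exists_block`). The automaton guesses such a block,
stores its length on the pushdown, and compares it with the number of letters `a`, which were
translucent until then. A separate guess covers the words without `a`.

For `Lrep` itself, suppose `M` recognises it in either mode, and follow an accepting computation on
`bⁿ#bⁿaⁿ`. The remaining input always has four slots of equal letters, so a step depends on the slot
counts only through which slots are empty. Hence parts of the computation can be replayed on other
counts and other stack bottoms, and cut out (`slotAccepts_of_excise`,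
`slotAccepts_of_excise_of_never_popped`). What is then accepted must still have three equal counts.

The two blocks of `b` cannot be consumed in turns. While `#` is present, the first block hides the
second; once `#` is gone, the head itself must mark the boundary, since otherwise a `b` could be
moved across it unnoticed (`first_block_first`, `zone_of_hash_read`). So between two configurations
of the same profile only one block shrinks, and cutting out that part alone is possible only if it
reads nothing (`count_eq_of_excise_one`).

Input-drivenness bounds the stack (`length_stack_le`). In a high stack, two levels have matching
profiles both where they are last left on the way up and where they are first reached on the way
down. Cutting out the two corresponding parts removes `d` letters from each of the three large
slots. With `σ, σ' ∈ {-1, 0, 1}` the height changes of `b` and `a`, the parts change the height by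
`(2σ + σ')d` in total, which must be `0`; this forces `d = 0` or `σ = σ' = 0`, and in both cases the
levels coincide.

With bounded stacks there are finitely many pairs of stack and profile, while almost all of the `n`
letters `a` have to be read. For large `n` a pair recurs with a different number of letters `a`, and
cutting out the part in between is a contradiction (`RepRun.exists_not`). -/

namespace TransPDA

/-! ### Both modes as one transition system on head configurations. -/

namespace PDA

variable {A Q G : Type}

/-- Reading the letter `a` in state `q` with pushdown content `γ` may lead to state `q'` with
pushdown content `γ'`. -/
def LetterMove (M : PDA A Q G) (q : Q) (a : A) (γ : List G) (q' : Q) (γ' : List G) : Prop :=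
  (∃ (h : M.sig a = Action.push) (S : Set (Q × G)) (z : G),
    M.δD q ⟨a, h⟩ γ.head? = Outcome.moves S ∧ (q', z) ∈ S ∧ γ' = z :: γ) ∨
  (∃ (h : M.sig a = Action.pop) (S : Set Q),
    M.δR q ⟨a, h⟩ γ.head? = Outcome.moves S ∧ q' ∈ S ∧ γ' = γ.tail) ∨
  (∃ (h : M.sig a = Action.neutral) (S : Set Q),
    M.δN q (some ⟨a, h⟩) γ.head? = Outcome.moves S ∧ q' ∈ S ∧ γ' = γ)

/-- Reading the endmarker in state `q` with pushdown content `γ` may lead to state `q'`. -/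
def EndMove (M : PDA A Q G) (q : Q) (γ : List G) (q' : Q) : Prop :=
  ∃ S : Set Q, M.δN q none γ.head? = Outcome.moves S ∧ q' ∈ S

/-- Reading the letter `a` in state `q` with pushdown content `γ` accepts. -/
def LetterAccept (M : PDA A Q G) (q : Q) (a : A) (γ : List G) : Prop :=
  (∃ h : M.sig a = Action.push, M.δD q ⟨a, h⟩ γ.head? = Outcome.accept) ∨
  (∃ h : M.sig a = Action.pop, M.δR q ⟨a, h⟩ γ.head? = Outcome.accept) ∨
  (∃ h : M.sig a = Action.neutral, M.δN q (some ⟨a, h⟩) γ.head? = Outcome.accept)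

/-- Reading the endmarker in state `q` with pushdown content `γ` accepts. -/
def EndAccept (M : PDA A Q G) (q : Q) (γ : List G) : Prop :=
  M.δN q none γ.head? = Outcome.accept

end PDA

/-- A non-accepting configuration: remaining input on both sides of the head, state, pushdown
content. -/
structure HeadConf (A Q G : Type) where
  left : List A
  state : Q
  right : List A
  stack : List G

namespace PDA

variable {A Q G : Type}

/-- One step in either mode; `ret` tells whether the head returns to the left end after a letter
has been processed. -/
inductive HeadStep (M : PDA A Q G) (ret : Bool) : HeadConf A Q G → HeadConf A Q G → Prop
  | letter (u : List A) (q q' : Q) (x y : List A) (a : A) (γ γ' : List G)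
      (hx : ∀ c ∈ x, c ∈ M.τ q) (ha : a ∉ M.τ q) (h : M.LetterMove q a γ q' γ') :
      HeadStep M ret ⟨u, q, x ++ a :: y, γ⟩
        ⟨bif ret then [] else u ++ x, q', bif ret then u ++ x ++ y else y, γ'⟩
  | endmarker (u : List A) (q q' : Q) (x : List A) (γ : List G)
      (hx : ∀ c ∈ x, c ∈ M.τ q) (h : M.EndMove q γ q') :
      HeadStep M ret ⟨u, q, x, γ⟩ ⟨[], q', u ++ x, γ⟩

/-- The next step may accept. -/
def HeadAccepting (M : PDA A Q G) (c : HeadConf A Q G) : Prop :=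
  (∃ x a y, c.right = x ++ a :: y ∧ (∀ d ∈ x, d ∈ M.τ c.state) ∧ a ∉ M.τ c.state ∧
    M.LetterAccept c.state a c.stack) ∨
  ((∀ d ∈ c.right, d ∈ M.τ c.state) ∧ M.EndAccept c.state c.stack)

/-- Some computation from the configuration `c` accepts. -/
def HeadAccepts (M : PDA A Q G) (ret : Bool) (c : HeadConf A Q G) : Prop :=
  ∃ d, Relation.ReflTransGen (M.HeadStep ret) c d ∧ M.HeadAccepting d

theorem HeadAccepts.head {M : PDA A Q G} {ret : Bool} {c d : HeadConf A Q G}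
    (h : M.HeadStep ret c d) (hd : M.HeadAccepts ret d) : M.HeadAccepts ret c := by
  obtain ⟨e, h1, h2⟩ := hd
  exact ⟨e, .head h h1, h2⟩

theorem HeadAccepts.trans {M : PDA A Q G} {ret : Bool} {c d : HeadConf A Q G}
    (h : Relation.ReflTransGen (M.HeadStep ret) c d) (hd : M.HeadAccepts ret d) :
    M.HeadAccepts ret c := by
  obtain ⟨e, h1, h2⟩ := hd
  exact ⟨e, h.trans h1, h2⟩

theorem headAccepts_of_nr (M : PDA A Q G) {c : NRConf A Q G}
    (h : Relation.ReflTransGen M.NRStep c .accept) :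
    ∀ u q w γ, c = .conf u q w γ → M.HeadAccepts false ⟨u, q, w, γ⟩ := by
  induction h using Relation.ReflTransGen.head_induction_on with
  | refl => rintro u q w γ ⟨⟩
  | head hs _ ih =>
    rintro u q w γ rfl
    cases hs with
    | push _ q q' x y a γ z' S hx ha h hδ hS =>
      exact .head (.letter _ _ _ _ _ _ _ _ hx ha (.inl ⟨h, S, z', hδ, hS, rfl⟩)) (ih _ _ _ _ rfl)
    | pop _ q q' x y a γ S hx ha h hδ hS =>
      exact .head (.letter _ _ _ _ _ _ _ _ hx ha (.inr (.inl ⟨h, S, hδ, hS, rfl⟩)))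
        (ih _ _ _ _ rfl)
    | neutral _ q q' x y a γ S hx ha h hδ hS =>
      exact .head (.letter _ _ _ _ _ _ _ _ hx ha (.inr (.inr ⟨h, S, hδ, hS, rfl⟩)))
        (ih _ _ _ _ rfl)
    | endmarker _ q q' x γ S hx hδ hS =>
      exact .head (.endmarker _ _ _ _ _ hx ⟨S, hδ, hS⟩) (ih _ _ _ _ rfl)
    | acceptPush _ q x y a γ hx ha h hδ =>
      exact ⟨_, .refl, .inl ⟨x, a, y, rfl, hx, ha, .inl ⟨h, hδ⟩⟩⟩
    | acceptPop _ q x y a γ hx ha h hδ =>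
      exact ⟨_, .refl, .inl ⟨x, a, y, rfl, hx, ha, .inr (.inl ⟨h, hδ⟩)⟩⟩
    | acceptNeutral _ q x y a γ hx ha h hδ =>
      exact ⟨_, .refl, .inl ⟨x, a, y, rfl, hx, ha, .inr (.inr ⟨h, hδ⟩)⟩⟩
    | acceptEndmarker _ q x γ hx hδ =>
      exact ⟨_, .refl, .inr ⟨hx, hδ⟩⟩

theorem nrStep_of_headStep {M : PDA A Q G} {c d : HeadConf A Q G} (h : M.HeadStep false c d) :
    M.NRStep (.conf c.left c.state c.right c.stack) (.conf d.left d.state d.right d.stack) := by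
  cases h with
  | letter u q q' x y a γ γ' hx ha h =>
    rcases h with ⟨h, S, z, hδ, hS, rfl⟩ | ⟨h, S, hδ, hS, rfl⟩ | ⟨h, S, hδ, hS, rfl⟩
    · exact .push _ _ _ _ _ _ _ _ _ hx ha h hδ hS
    · exact .pop _ _ _ _ _ _ _ _ hx ha h hδ hS
    · exact .neutral _ _ _ _ _ _ _ _ hx ha h hδ hS
  | endmarker u q q' x γ hx h =>
    obtain ⟨S, hδ, hS⟩ := h
    exact .endmarker _ _ _ _ _ _ hx hδ hS

theorem nrStep_accept {M : PDA A Q G} {c : HeadConf A Q G} (h : M.HeadAccepting c) :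
    M.NRStep (.conf c.left c.state c.right c.stack) .accept := by
  obtain ⟨u, q, w, γ⟩ := c
  rcases h with ⟨x, a, y, rfl : w = _, hx, ha, h⟩ | ⟨hx, h⟩
  · rcases h with ⟨h, hδ⟩ | ⟨h, hδ⟩ | ⟨h, hδ⟩
    · exact .acceptPush _ _ _ _ _ _ hx ha h hδ
    · exact .acceptPop _ _ _ _ _ _ hx ha h hδ
    · exact .acceptNeutral _ _ _ _ _ _ hx ha h hδ
  · exact .acceptEndmarker _ _ _ _ hx h

theorem mem_nonretLanguage_iff (M : PDA A Q G) (w : List A) :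
    w ∈ M.nonretLanguage ↔ M.HeadAccepts false ⟨[], M.q₀, w, []⟩ := by
  refine ⟨fun h => M.headAccepts_of_nr h _ _ _ _ rfl, ?_⟩
  rintro ⟨d, h1, h2⟩
  exact (h1.lift (fun c : HeadConf A Q G => NRConf.conf c.left c.state c.right c.stack)
    fun _ _ => nrStep_of_headStep).tail (nrStep_accept h2)

theorem headAccepts_of_r (M : PDA A Q G) {c : RConf A Q G}
    (h : Relation.ReflTransGen M.RStep c .accept) :
    ∀ q w γ, c = .conf q w γ → M.HeadAccepts true ⟨[], q, w, γ⟩ := by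
  induction h using Relation.ReflTransGen.head_induction_on with
  | refl => rintro q w γ ⟨⟩
  | head hs _ ih =>
    rintro q w γ rfl
    cases hs with
    | push q q' x y a γ z' S hx ha h hδ hS =>
      exact .head (.letter _ _ _ _ _ _ _ _ hx ha (.inl ⟨h, S, z', hδ, hS, rfl⟩)) (ih _ _ _ rfl)
    | pop q q' x y a γ S hx ha h hδ hS =>
      exact .head (.letter _ _ _ _ _ _ _ _ hx ha (.inr (.inl ⟨h, S, hδ, hS, rfl⟩)))
        (ih _ _ _ rfl)
    | neutral q q' x y a γ S hx ha h hδ hS =>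
      exact .head (.letter _ _ _ _ _ _ _ _ hx ha (.inr (.inr ⟨h, S, hδ, hS, rfl⟩)))
        (ih _ _ _ rfl)
    | endmarker q q' x γ S hx hδ hS =>
      exact .head (.endmarker _ _ _ _ _ hx ⟨S, hδ, hS⟩) (ih _ _ _ rfl)
    | acceptPush q x y a γ hx ha h hδ =>
      exact ⟨_, .refl, .inl ⟨x, a, y, rfl, hx, ha, .inl ⟨h, hδ⟩⟩⟩
    | acceptPop q x y a γ hx ha h hδ =>
      exact ⟨_, .refl, .inl ⟨x, a, y, rfl, hx, ha, .inr (.inl ⟨h, hδ⟩)⟩⟩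
    | acceptNeutral q x y a γ hx ha h hδ =>
      exact ⟨_, .refl, .inl ⟨x, a, y, rfl, hx, ha, .inr (.inr ⟨h, hδ⟩)⟩⟩
    | acceptEndmarker q x γ hx hδ =>
      exact ⟨_, .refl, .inr ⟨hx, hδ⟩⟩

/-- In the returning mode nothing is ever left of the head, so forgetting `left` loses no
information; the second component keeps this invariant going. -/
theorem rStep_of_headStep {M : PDA A Q G} {c d : HeadConf A Q G} (h : M.HeadStep true c d)
    (hc : c.left = []) :
    M.RStep (.conf c.state c.right c.stack) (.conf d.state d.right d.stack) ∧ d.left = [] := by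
  cases h with
  | letter u q q' x y a γ γ' hx ha h =>
    obtain rfl : u = [] := hc
    refine ⟨?_, rfl⟩
    rcases h with ⟨h, S, z, hδ, hS, rfl⟩ | ⟨h, S, hδ, hS, rfl⟩ | ⟨h, S, hδ, hS, rfl⟩
    · exact .push _ _ _ _ _ _ _ _ hx ha h hδ hS
    · exact .pop _ _ _ _ _ _ _ hx ha h hδ hS
    · exact .neutral _ _ _ _ _ _ _ hx ha h hδ hS
  | endmarker u q q' x γ hx h =>
    obtain rfl : u = [] := hc
    obtain ⟨S, hδ, hS⟩ := h
    exact ⟨.endmarker _ _ _ _ _ hx hδ hS, rfl⟩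

theorem rStep_accept {M : PDA A Q G} {c : HeadConf A Q G} (h : M.HeadAccepting c) :
    M.RStep (.conf c.state c.right c.stack) .accept := by
  obtain ⟨u, q, w, γ⟩ := c
  rcases h with ⟨x, a, y, rfl : w = _, hx, ha, h⟩ | ⟨hx, h⟩
  · rcases h with ⟨h, hδ⟩ | ⟨h, hδ⟩ | ⟨h, hδ⟩
    · exact .acceptPush _ _ _ _ _ hx ha h hδ
    · exact .acceptPop _ _ _ _ _ hx ha h hδ
    · exact .acceptNeutral _ _ _ _ _ hx ha h hδ
  · exact .acceptEndmarker _ _ _ hx h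

theorem mem_retLanguage_iff (M : PDA A Q G) (w : List A) :
    w ∈ M.retLanguage ↔ M.HeadAccepts true ⟨[], M.q₀, w, []⟩ := by
  refine ⟨fun h => M.headAccepts_of_r h _ _ _ rfl, ?_⟩
  rintro ⟨d, h1, h2⟩
  have : Relation.ReflTransGen M.RStep (.conf M.q₀ w [])
      (.conf d.state d.right d.stack) ∧ d.left = [] := by
    clear h2
    induction h1 with
    | refl => exact ⟨.refl, rfl⟩
    | tail _ hs ih =>
      obtain ⟨h1, h2⟩ := rStep_of_headStep hs ih.2
      exact ⟨ih.1.tail h1, h2⟩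
  exact this.1.tail (rStep_accept h2)

end PDA

/-! ### Membership in `Lrep` by erasure and counting. -/

/-- The projection that erases the letter `a`. -/
def eraseA (w : List Letter) : List Letter := w.filter (· ≠ Letter.a)

@[simp] theorem eraseA_nil : eraseA [] = [] := rfl

@[simp] theorem eraseA_append (u v : List Letter) : eraseA (u ++ v) = eraseA u ++ eraseA v := by
  simp [eraseA]

@[simp] theorem eraseA_cons_a (u : List Letter) : eraseA (Letter.a :: u) = eraseA u := by
  simp [eraseA]

theorem eraseA_cons_of_ne {c : Letter} (h : c ≠ Letter.a) (u : List Letter) :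
    eraseA (c :: u) = c :: eraseA u := by
  simp [eraseA, h]

theorem eraseA_eq_self {w : List Letter} (h : Letter.a ∉ w) : eraseA w = w :=
  List.filter_eq_self.2 fun c hc => by
    have : c ≠ Letter.a := fun hca => h (hca ▸ hc)
    simpa using this

theorem eraseA_eq_nil {w : List Letter} (h : ∀ c ∈ w, c = Letter.a) : eraseA w = [] := by
  simpa [eraseA] using h

theorem a_notMem_repWord (n k : ℕ) : Letter.a ∉ repWord n k := by
  simp [repWord, List.mem_replicate]

theorem eraseA_flatten_pairs (p : List (List Letter × List Letter))
    (h₁ : Letter.a ∉ (p.map Prod.fst).flatten) (h₂ : ∀ c ∈ (p.map Prod.snd).flatten, c = Letter.a) :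
    eraseA (p.map fun xy => xy.1 ++ xy.2).flatten = (p.map Prod.fst).flatten ∧
      (p.map fun xy => xy.1 ++ xy.2).flatten.count Letter.a =
        (p.map Prod.snd).flatten.length := by
  induction p with
  | nil => simp
  | cons xy p ih =>
    simp only [List.map_cons, List.flatten_cons, List.mem_append, not_or] at h₁ h₂
    obtain ⟨ih1, ih2⟩ := ih h₁.2 fun c hc => h₂ c (.inr hc)
    have hy : ∀ c ∈ xy.2, c = Letter.a := fun c hc => h₂ c (.inl hc)
    have hc : xy.2.count Letter.a = xy.2.length := List.count_eq_length.2 fun c hc => (hy c hc).symm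
    simp only [List.map_cons, List.flatten_cons, eraseA_append, List.count_append,
      List.length_append, ih1, ih2, eraseA_eq_self h₁.1, eraseA_eq_nil hy, hc,
      List.count_eq_zero.2 h₁.1]
    simp

/-- The two shuffled words have disjoint alphabets, so each is recovered from the shuffle by
projection, and every interleaving is allowed. -/
theorem mem_Lrep_iff (w : List Letter) :
    w ∈ Lrep ↔ ∃ n k, 1 ≤ n ∧ eraseA w = repWord n k ∧ w.count Letter.a = n := by
  constructor
  · rintro ⟨n, k, hn, p, h1, h2, rfl⟩
    have h1 : (p.map Prod.fst).flatten = repWord n k := h1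
    have h2 : (p.map Prod.snd).flatten = List.replicate n Letter.a := h2
    obtain ⟨h3, h4⟩ := eraseA_flatten_pairs p (h1 ▸ a_notMem_repWord n k)
      (by rw [h2]; exact fun c hc => List.eq_of_mem_replicate hc)
    exact ⟨n, k, hn, h3.trans h1, by rw [h4, h2, List.length_replicate]⟩
  · rintro ⟨n, k, hn, h1, h2⟩
    let f : Letter → List Letter × List Letter := fun c =>
      if c = Letter.a then ([], [Letter.a]) else ([c], [])
    have hf : ∀ v : List Letter, ((v.map f).map Prod.fst).flatten = eraseA v ∧
        ((v.map f).map Prod.snd).flatten = List.replicate (v.count Letter.a) Letter.a ∧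
        v = ((v.map f).map fun xy => xy.1 ++ xy.2).flatten := by
      intro v
      induction v with
      | nil => simp
      | cons c v ih =>
        obtain ⟨i1, i2, i3⟩ := ih
        simp only [List.map_cons, List.flatten_cons, i1, i2, ← i3]
        by_cases hc : c = Letter.a
        · subst hc; simp [f, List.replicate_succ]
        · simp [f, hc, eraseA_cons_of_ne hc]
    exact ⟨n, k, hn, w.map f, (hf w).1.trans h1, (hf w).2.1.trans (by rw [h2]), (hf w).2.2⟩

/-! ### An automaton for the complement. -/

/-- The states of the automaton for the complement of `Lrep`. -/
inductive ComplementState where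
  | start
  | skip
  | count
  | rewind
  | compare
  | noA
  deriving DecidableEq

instance : Fintype ComplementState where
  elems := {ComplementState.start, ComplementState.skip, ComplementState.count,
    ComplementState.rewind, ComplementState.compare, ComplementState.noA}
  complete x := by cases x <;> simp

/-- An automaton that guesses that there is no `a`, or guesses a block of letters `b`, pushes
`true` for each letter of it, and compares its length with the number of letters `a`. -/
def complementPDA : PDA Letter ComplementState Bool where
  sig
    | .a => .pop
    | .b => .push
    | .hash => .neutral
  q₀ := .start
  τ
    | .start => Set.univ
    | .skip => {.a}
    | .count => {.a}
    -- With every letter translucent, the next step is on the endmarker; this brings the head back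
    -- to the left end also in the non-returning mode.
    | .rewind => Set.univ
    | .compare => {c | c ≠ .a}
    | .noA => {c | c ≠ .a}
  δD q _ _ := match q with
    -- An input-driven automaton must push on every `b`, also on those it does not count; `false`
    -- keeps them apart from the counted ones above.
    | .skip => .moves {(.skip, false)}
    | .count => .moves {(.count, true)}
    | _ => .undefined
  δR q _ z := match q, z with
    | .compare, some true => .moves {.compare}
    -- An `a` is scanned after all marks `true` are gone: there are more letters `a` than letters in
    -- the block.
    | .compare, _ => .accept
    | _, _ => .undefined
  δN q c z := match q, c, z with
    | .start, none, _ => .moves {.skip, .count, .noA}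
    | .skip, some _, _ => .moves {.skip, .count}
    | .count, _, _ => .moves {.rewind}
    | .rewind, none, _ => .moves {.compare}
    | .compare, none, some true => .accept
    | .noA, none, _ => .accept
    | _, _, _ => .undefined

namespace complementPDA

open PDA

/-- The word `bⁱ(#bⁿ)ᵏ`. -/
def repSuffix (i n k : ℕ) : List Letter :=
  List.replicate i Letter.b ++
    (List.replicate k (Letter.hash :: List.replicate n Letter.b)).flatten

theorem repSuffix_eq_cons {i n k : ℕ} {c : Letter} {v : List Letter}
    (h : repSuffix i n k = c :: v) :
    (c = .b ∧ ∃ i', i = i' + 1 ∧ v = repSuffix i' n k) ∨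
      (c = .hash ∧ i = 0 ∧ ∃ k', v = repSuffix n n k') := by
  rcases i with _ | i
  · rcases k with _ | k
    · simp [repSuffix] at h
    · simp only [repSuffix, List.replicate_zero, List.nil_append, List.replicate_succ,
        List.flatten_cons, List.cons_append, List.cons.injEq] at h
      exact .inr ⟨h.1.symm, rfl, k, h.2.symm⟩
  · simp only [repSuffix, List.replicate_succ, List.cons_append, List.cons.injEq] at h
    exact .inl ⟨h.1.symm, i, rfl, h.2.symm⟩

theorem repSuffix_eq_nil {i n k : ℕ} (h : repSuffix i n k = []) : i = 0 := by
  simp [repSuffix] at h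
  exact h.1

/-- The invariant of the computations on a word of `Lrep` with `n` letters `a`. -/
def Inv (n : ℕ) (c : HeadConf Letter ComplementState Bool) : Prop :=
  match c.state with
  | .start => c.left = [] ∧ c.stack = [] ∧ (∃ k, eraseA c.right = repSuffix n n k) ∧
      c.right.count .a = n
  | .skip => eraseA c.left = [] ∧ (∀ z ∈ c.stack, z = false) ∧
      (∃ i k, eraseA c.right = repSuffix i n k) ∧ (c.left ++ c.right).count .a = n
  | .count => eraseA c.left = [] ∧ (∃ m i k γ, c.stack = List.replicate m true ++ γ ∧
      (∀ z ∈ γ, z = false) ∧ eraseA c.right = repSuffix i n k ∧ m + i = n) ∧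
      (c.left ++ c.right).count .a = n
  | .rewind => (∃ γ, c.stack = List.replicate n true ++ γ ∧ (∀ z ∈ γ, z = false)) ∧
      (c.left ++ c.right).count .a = n
  | .compare => c.left.count .a = 0 ∧ ∃ m γ, c.stack = List.replicate m true ++ γ ∧
      (∀ z ∈ γ, z = false) ∧ c.right.count .a = m
  | .noA => c.left = [] ∧ c.right.count .a = n

/-- No `a` is deleted before `compare`, and the letters `b` and `#` are read strictly from left to
right. So every counted block leaves exactly `n` marks, and `compare` keeps marks and letters `a`
balanced. -/
theorem Inv.step {n : ℕ} {ret : Bool} {c d : HeadConf Letter ComplementState Bool}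
    (h : complementPDA.HeadStep ret c d) (hc : Inv n c) : Inv n d := by
  cases h with
  | letter u q q' x y e γ γ' hx ha h =>
    cases q with
    | start => simp [complementPDA] at ha
    | rewind => simp [complementPDA] at ha
    | noA =>
      obtain rfl : e = .a := by simpa [complementPDA] using ha
      simp [LetterMove, complementPDA] at h
    | skip =>
      have ha : e ≠ .a := ha
      have hx : eraseA x = [] := eraseA_eq_nil hx
      obtain ⟨h1, h2, ⟨i, k, h3⟩, h4⟩ := hc
      simp only [eraseA_append, hx, List.nil_append, eraseA_cons_of_ne ha] at h3 h1
      simp only [List.count_append, List.count_cons_of_ne ha] at h4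
      rcases repSuffix_eq_cons h3.symm with ⟨rfl, i', rfl, h5⟩ | ⟨rfl, rfl, k', h5⟩
      · simp [LetterMove, complementPDA] at h
        obtain ⟨rfl, rfl⟩ := h
        refine ⟨by cases ret <;> simp [h1, hx], by simpa using h2, ⟨i', k, ?_⟩, ?_⟩ <;>
          cases ret <;> simp [h1, hx, h5] <;> omega
      · simp [LetterMove, complementPDA] at h
        obtain ⟨rfl | rfl, rfl⟩ := h
        · refine ⟨by cases ret <;> simp [h1, hx], by simpa using h2, ⟨n, k', ?_⟩, ?_⟩ <;>
            cases ret <;> simp [h1, hx, h5] <;> omega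
        · refine ⟨by cases ret <;> simp [h1, hx], ⟨0, n, k', _, rfl, h2, ?_, ?_⟩, ?_⟩ <;>
            cases ret <;> simp [h1, hx, h5] <;> omega
    | count =>
      have ha : e ≠ .a := ha
      have hx : eraseA x = [] := eraseA_eq_nil hx
      obtain ⟨h1, ⟨m, i, k, γ, rfl, h2, h3, h6⟩, h4⟩ := hc
      simp only [eraseA_append, hx, List.nil_append, eraseA_cons_of_ne ha] at h3 h1
      simp only [List.count_append, List.count_cons_of_ne ha] at h4
      rcases repSuffix_eq_cons h3.symm with ⟨rfl, i', rfl, h5⟩ | ⟨rfl, rfl, k', h5⟩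
      · simp [LetterMove, complementPDA] at h
        obtain ⟨rfl, rfl⟩ := h
        refine ⟨by cases ret <;> simp [h1, hx], ⟨m + 1, i', k, γ, rfl, h2, ?_, by omega⟩, ?_⟩ <;>
          cases ret <;> simp [h1, hx, h5] <;> omega
      · simp [LetterMove, complementPDA] at h
        obtain ⟨rfl, rfl⟩ := h
        -- Reading `#` means that the block is exhausted, so all its `n` letters have been counted.
        obtain rfl : m = n := by omega
        refine ⟨⟨_, rfl, h2⟩, ?_⟩
        cases ret <;> (simp; omega)
    | compare =>
      obtain rfl : e = .a := by simpa [complementPDA] using ha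
      have hx : x.count .a = 0 := List.count_eq_zero.2 fun h => hx _ h rfl
      obtain ⟨h1, m, γ, rfl, h2, h3⟩ := hc
      simp only [List.count_append, hx, List.count_cons_self] at h3 h1
      rcases m with _ | m
      · omega
      · simp [LetterMove, complementPDA, List.replicate_succ] at h
        obtain ⟨rfl, rfl⟩ := h
        refine ⟨by cases ret <;> simp [h1, hx], m, _, rfl, h2, ?_⟩
        cases ret <;> simp [h1, hx] <;> omega
  | endmarker u q q' x γ hx h =>
    obtain ⟨S, h, hS⟩ := h
    cases q with
    | start =>
      obtain ⟨rfl : u = [], rfl : γ = [], ⟨k, h1⟩, h2⟩ := hc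
      simp only [complementPDA, Outcome.moves.injEq] at h
      subst h
      rcases hS with rfl | rfl | rfl
      · exact ⟨rfl, by simp, ⟨n, k, h1⟩, h2⟩
      · exact ⟨rfl, ⟨0, n, k, [], rfl, by simp, h1, by simp⟩, h2⟩
      · exact ⟨rfl, h2⟩
    | skip => simp [complementPDA] at h
    | noA => simp [complementPDA] at h
    | count =>
      have hx : eraseA x = [] := eraseA_eq_nil hx
      obtain ⟨h1, ⟨m, i, k, γ, rfl, h2, h3, h6⟩, h4⟩ := hc
      simp only [complementPDA, Outcome.moves.injEq] at h
      subst h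
      obtain rfl := hS
      obtain rfl := repSuffix_eq_nil (h3.symm.trans hx)
      obtain rfl : m = n := by omega
      exact ⟨⟨_, rfl, h2⟩, by simpa using h4⟩
    | rewind =>
      obtain ⟨⟨γ, rfl, h2⟩, h4⟩ := hc
      simp only [complementPDA, Outcome.moves.injEq] at h
      subst h
      obtain rfl := hS
      exact ⟨rfl, n, γ, rfl, h2, h4⟩
    | compare =>
      simp only [complementPDA] at h
      split at h <;> simp_all

theorem Inv.not_accepting {n : ℕ} (hn : 1 ≤ n) {c : HeadConf Letter ComplementState Bool}
    (hc : Inv n c) : ¬ complementPDA.HeadAccepting c := by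
  obtain ⟨u, q, w, γ⟩ := c
  rintro (⟨x, e, y, rfl : w = _, hx, ha, h⟩ | ⟨hx, h⟩)
  · cases q <;> try (simp [LetterAccept, complementPDA] at h; done)
    obtain rfl : e = .a := by simpa [complementPDA] using ha
    obtain ⟨h1, m, γ, rfl : _ = _, h2, h3⟩ := hc
    simp only [List.count_append, List.count_cons_self] at h3
    obtain ⟨m, rfl⟩ : ∃ k, m = k + 1 := ⟨m - 1, by omega⟩
    simp [LetterAccept, complementPDA, List.replicate_succ] at h
  · cases q <;> try (simp [EndAccept, complementPDA] at h; done)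
    · obtain ⟨h1, m, γ, rfl : _ = _, h2, h3 : w.count .a = m⟩ := hc
      rw [List.count_eq_zero.2 fun h => hx _ h rfl] at h3
      subst h3
      rcases γ with _ | ⟨z, γ⟩
      · simp [EndAccept, complementPDA] at h
      · obtain rfl := h2 z (by simp)
        simp [EndAccept, complementPDA] at h
    · obtain ⟨-, h3 : w.count .a = n⟩ := hc
      rw [List.count_eq_zero.2 fun h => hx _ h rfl] at h3
      omega

theorem not_accepts_of_mem {w : List Letter} (hw : w ∈ Lrep) (ret : Bool) :
    ¬ complementPDA.HeadAccepts ret ⟨[], complementPDA.q₀, w, []⟩ := by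
  obtain ⟨n, k, hn, h1, h2⟩ := (mem_Lrep_iff w).1 hw
  rintro ⟨d, hd, hacc⟩
  have : Inv n d := by
    clear hacc
    induction hd with
    | refl => exact ⟨rfl, rfl, ⟨k, h1⟩, h2⟩
    | tail _ hs ih => exact ih.step hs
  exact this.not_accepting hn hacc


theorem exists_of_eraseA_eq_cons {w v : List Letter} {d : Letter} (h : eraseA w = d :: v) :
    ∃ x y, w = x ++ d :: y ∧ (∀ c ∈ x, c = .a) ∧ d ≠ .a ∧ eraseA y = v := by
  obtain ⟨x, y, rfl, h1, h2, h3⟩ := List.filter_eq_cons_iff.1 h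
  exact ⟨x, y, rfl, by simpa using h1, by simpa using h2, h3⟩

/-- When only `a` is translucent, the automaton acts on the erased word as an ordinary left-to-right
automaton in both modes, because only letters `a` are passed over. -/
theorem exists_headStep {ret : Bool} {u w v : List Letter} {d : Letter} {q q' : ComplementState}
    {γ γ' : List Bool} (hτ : complementPDA.τ q = {.a}) (hu : eraseA u = [])
    (hw : eraseA w = d :: v) (h : complementPDA.LetterMove q d γ q' γ') :
    ∃ u' w', complementPDA.HeadStep ret ⟨u, q, w, γ⟩ ⟨u', q', w', γ'⟩ ∧ eraseA u' = [] ∧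
      eraseA w' = v ∧ (u' ++ w').count .a = (u ++ w).count .a := by
  obtain ⟨x, y, rfl, hx, hd, rfl⟩ := exists_of_eraseA_eq_cons hw
  refine ⟨_, _, .letter u q q' x y d γ γ' (by simpa [hτ] using hx) (by simpa [hτ] using hd) h,
    ?_, ?_, ?_⟩ <;> cases ret <;>
    simp [hu, eraseA_eq_nil hx, List.count_cons_of_ne hd]

theorem exists_count_block {ret : Bool} (m : ℕ) {u w v : List Letter} {γ : List Bool}
    (hu : eraseA u = []) (hw : eraseA w = List.replicate m .b ++ v) :
    ∃ u' w', Relation.ReflTransGen (complementPDA.HeadStep ret) ⟨u, .count, w, γ⟩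
        ⟨u', .count, w', List.replicate m true ++ γ⟩ ∧ eraseA u' = [] ∧
      eraseA w' = v ∧ (u' ++ w').count .a = (u ++ w).count .a := by
  induction m generalizing u w γ with
  | zero => exact ⟨u, w, .refl, hu, hw, rfl⟩
  | succ m ih =>
    obtain ⟨u₁, w₁, h1, h2, h3, h4⟩ := exists_headStep (ret := ret) (q := .count) (q' := .count)
      (γ := γ) (γ' := true :: γ) rfl hu hw (.inl ⟨rfl, _, _, rfl, rfl, rfl⟩)
    obtain ⟨u₂, w₂, h5, h6, h7, h8⟩ := ih h2 h3 (γ := true :: γ)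
    refine ⟨u₂, w₂, .head h1 ?_, h6, h7, h8.trans h4⟩
    rwa [List.replicate_succ', List.append_assoc]

theorem exists_skip {ret : Bool} (s : List Letter) {u w v : List Letter} {γ : List Bool}
    (hu : eraseA u = []) (hw : eraseA w = s ++ .hash :: v) (hγ : ∀ z ∈ γ, z = false) :
    ∃ u' w' γ', Relation.ReflTransGen (complementPDA.HeadStep ret) ⟨u, .skip, w, γ⟩
        ⟨u', .count, w', γ'⟩ ∧ (∀ z ∈ γ', z = false) ∧ eraseA u' = [] ∧
      eraseA w' = v ∧ (u' ++ w').count .a = (u ++ w).count .a := by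
  induction s generalizing u w γ with
  | nil =>
    obtain ⟨u₁, w₁, h1, h2, h3, h4⟩ := exists_headStep (ret := ret) (q := .skip) (q' := .count)
      (γ := γ) (γ' := γ) rfl hu hw (.inr (.inr ⟨rfl, _, rfl, .inr rfl, rfl⟩))
    exact ⟨u₁, w₁, γ, .single h1, hγ, h2, h3, h4⟩
  | cons c s ih =>
    have : ∃ γ₁ : List Bool, complementPDA.LetterMove .skip c γ .skip γ₁ ∧ ∀ z ∈ γ₁, z = false := by
      obtain ⟨-, -, -, -, hc, -⟩ := exists_of_eraseA_eq_cons hw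
      cases c with
      | a => exact absurd rfl hc
      | b => exact ⟨false :: γ, .inl ⟨rfl, _, _, rfl, rfl, rfl⟩, by simpa using hγ⟩
      | hash => exact ⟨γ, .inr (.inr ⟨rfl, _, rfl, .inl rfl, rfl⟩), hγ⟩
    obtain ⟨γ₁, hm, hγ₁⟩ := this
    obtain ⟨u₁, w₁, h1, h2, h3, h4⟩ := exists_headStep (ret := ret) rfl hu hw hm
    obtain ⟨u₂, w₂, γ₂, h5, h6, h7, h8, h9⟩ := ih h2 h3 hγ₁
    exact ⟨u₂, w₂, γ₂, .head h1 h5, h6, h7, h8, h9.trans h4⟩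

/-- Marks and letters `a` are cancelled one against one until one kind runs out; by inequality the
other is still there, and either situation accepts. -/
theorem headAccepts_compare {ret : Bool} (m : ℕ) {u w : List Letter} {γ : List Bool}
    (hu : u.count .a = 0) (hγ : ∀ z ∈ γ, z = false) (hm : w.count .a ≠ m) :
    complementPDA.HeadAccepts ret ⟨u, .compare, w, List.replicate m true ++ γ⟩ := by
  by_cases hw : Letter.a ∈ w
  · obtain ⟨x, y, rfl, hx⟩ := List.eq_append_cons_of_mem hw
    have hx' : ∀ c ∈ x, c ∈ complementPDA.τ .compare := fun c hc hca => hx (hca ▸ hc)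
    have ha : Letter.a ∉ complementPDA.τ .compare := fun h => h rfl
    induction m generalizing u x y with
    | zero =>
      refine ⟨_, .refl, .inl ⟨x, .a, y, rfl, hx', ha, .inr (.inl ⟨rfl, ?_⟩)⟩⟩
      rcases γ with _ | ⟨z, γ⟩
      · rfl
      · obtain rfl := hγ z (by simp)
        rfl
    | succ m ih =>
      have hstep := HeadStep.letter (M := complementPDA) (ret := ret) u .compare .compare x y .a
        (List.replicate (m + 1) true ++ γ) (List.replicate m true ++ γ) hx' ha
        (.inr (.inl ⟨rfl, _, rfl, rfl, rfl⟩))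
      refine .head hstep ?_
      have hx0 := List.count_eq_zero.2 hx
      simp only [List.count_append, List.count_cons_self, hx0] at hm
      set u' := bif ret then [] else u ++ x with hu'
      set w' := bif ret then u ++ x ++ y else y with hw'
      have h1 : u'.count .a = 0 := by cases ret <;> simp [hu', hu, hx0]
      have h2 : w'.count .a = y.count .a := by cases ret <;> simp [hw', hu, hx0]
      by_cases hmem : Letter.a ∈ w'
      · obtain ⟨x₁, y₁, h3, hx₁⟩ := List.eq_append_cons_of_mem hmem
        rw [h3] at h2 hmem ⊢
        exact ih h1 x₁ y₁ hx₁ (by omega) hmem fun c hc hca => hx₁ (hca ▸ hc)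
      · obtain ⟨m, rfl⟩ : ∃ k, m = k + 1 := by
          rw [List.count_eq_zero.2 hmem] at h2
          exact ⟨m - 1, by omega⟩
        exact ⟨_, .refl, .inr ⟨fun c hc hca => hmem (hca ▸ hc), rfl⟩⟩
  · obtain ⟨m, rfl⟩ : ∃ k, m = k + 1 := by
      rw [List.count_eq_zero.2 hw] at hm
      exact ⟨m - 1, by omega⟩
    exact ⟨_, .refl, .inr ⟨fun c hc hca => hw (hca ▸ hc), rfl⟩⟩

theorem headAccepts_count {ret : Bool} {m : ℕ} {u w v : List Letter} {γ : List Bool}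
    (hu : eraseA u = []) (hw : eraseA w = List.replicate m .b ++ v)
    (hv : v = [] ∨ ∃ v', v = .hash :: v') (hγ : ∀ z ∈ γ, z = false)
    (hm : (u ++ w).count .a ≠ m) :
    complementPDA.HeadAccepts ret ⟨u, .count, w, γ⟩ := by
  obtain ⟨u₁, w₁, h1, h2, h3, h4⟩ := exists_count_block (ret := ret) m (γ := γ) hu hw
  refine .trans h1 ?_
  have key : ∃ u₂ w₂, complementPDA.HeadStep ret ⟨u₁, .count, w₁, List.replicate m true ++ γ⟩
      ⟨u₂, .rewind, w₂, List.replicate m true ++ γ⟩ ∧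
        (u₂ ++ w₂).count .a = (u₁ ++ w₁).count .a := by
    rcases hv with rfl | ⟨v', rfl⟩
    · refine ⟨_, _, .endmarker _ _ _ _ _ (fun c hc => ?_) ⟨_, rfl, rfl⟩, by simp⟩
      have : c = .a := by simpa using List.filter_eq_nil_iff.1 h3 c hc
      exact this
    · obtain ⟨u₂, w₂, h5, -, -, h6⟩ := exists_headStep (ret := ret) (q := .count) (q' := .rewind)
        (γ := List.replicate m true ++ γ) rfl h2 h3 (.inr (.inr ⟨rfl, _, rfl, rfl, rfl⟩))
      exact ⟨u₂, w₂, h5, h6⟩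
  obtain ⟨u₂, w₂, h5, h6⟩ := key
  refine .head h5 (.head (.endmarker _ _ .compare _ _ (fun c _ => Set.mem_univ c) ⟨_, rfl, rfl⟩) ?_)
  exact headAccepts_compare m rfl hγ (by rw [h6, h4]; exact hm)

/-- Strip the first maximal block: either its length is wrong, or the rest after the next `#` is
shorter and has the same alternative. The condition on `v'` expresses that the block is maximal to
the right. -/
theorem eq_repWord_or_exists_block (n : ℕ) (v : List Letter) (hv : Letter.a ∉ v) :
    (∃ k, v = repWord n k) ∨ ∃ m v', m ≠ n ∧ (v' = [] ∨ ∃ v'', v' = .hash :: v'') ∧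
      (v = List.replicate m .b ++ v' ∨ ∃ s, v = s ++ .hash :: (List.replicate m .b ++ v')) := by
  induction hl : v.length using Nat.strong_induction_on generalizing v with | _ l ih
  subst hl
  obtain ⟨m, v', hv', rfl⟩ : ∃ m v', (v' = [] ∨ ∃ v'', v' = .hash :: v'') ∧
      v = List.replicate m .b ++ v' := by
    clear ih
    induction v with
    | nil => exact ⟨0, [], .inl rfl, rfl⟩
    | cons c v ih =>
      cases c with
      | a => simp at hv
      | hash => exact ⟨0, _, .inr ⟨_, rfl⟩, rfl⟩
      | b =>
        obtain ⟨m, v', h1, rfl⟩ := ih (by simpa using hv)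
        exact ⟨m + 1, v', h1, rfl⟩
  by_cases hm : m = n
  · subst hm
    rcases hv' with rfl | ⟨v', rfl⟩
    · exact .inl ⟨0, by simp [repWord]⟩
    · have hlt : v'.length < (List.replicate m Letter.b ++ .hash :: v').length := by simp; omega
      rcases ih _ hlt v' (fun h => hv (by simp [h])) rfl with
        ⟨k, rfl⟩ | ⟨m', v'', h1, h2, h3⟩
      · exact .inl ⟨k + 1, by simp [repWord, List.replicate_succ]⟩
      · refine .inr ⟨m', v'', h1, h2, .inr ?_⟩
        rcases h3 with rfl | ⟨s, rfl⟩
        · exact ⟨_, rfl⟩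
        · exact ⟨List.replicate m .b ++ .hash :: s, by simp⟩
  · exact .inr ⟨m, v', hm, hv', .inl rfl⟩

theorem accepts_of_notMem {w : List Letter} (hw : w ∉ Lrep) (ret : Bool) :
    complementPDA.HeadAccepts ret ⟨[], complementPDA.q₀, w, []⟩ := by
  have start : ∀ q, q ∈ ({.skip, .count, .noA} : Set ComplementState) →
      complementPDA.HeadStep ret ⟨[], complementPDA.q₀, w, []⟩ ⟨[], q, w, []⟩ := fun q hq =>
    .endmarker [] .start q w [] (fun c _ => Set.mem_univ c) ⟨_, rfl, hq⟩
  by_cases hn : w.count .a = 0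
  · refine .head (start .noA (by simp)) ⟨_, .refl, .inr ⟨fun c hc hca => ?_, rfl⟩⟩
    exact List.count_eq_zero.1 hn (hca ▸ hc)
  · have hv : Letter.a ∉ eraseA w := by simp [eraseA]
    rcases eq_repWord_or_exists_block (w.count .a) (eraseA w) hv with
      ⟨k, hk⟩ | ⟨m, v', h1, h2, h3⟩
    · exact absurd ((mem_Lrep_iff w).2 ⟨_, k, by omega, hk, rfl⟩) hw
    · rcases h3 with h3 | ⟨s, h3⟩
      · exact .head (start .count (by simp))
          (headAccepts_count rfl h3 h2 (by simp) fun h => h1 h.symm)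
      · obtain ⟨u', w', γ', h4, h5, h6, h7, h8⟩ := exists_skip (ret := ret) s (γ := [])
          (u := []) rfl h3 (by simp)
        exact .head (start .skip (by simp)) (.trans h4
          (headAccepts_count h6 h7 h2 h5 fun h => h1 (h.symm.trans h8)))

theorem headAccepts_iff (w : List Letter) (ret : Bool) :
    complementPDA.HeadAccepts ret ⟨[], complementPDA.q₀, w, []⟩ ↔ w ∉ Lrep :=
  ⟨fun h hw => not_accepts_of_mem hw ret h, fun h => accepts_of_notMem h ret⟩

end complementPDA

theorem compl_Lrep_mem_NIDPDAwtl : Lrepᶜ ∈ NIDPDAwtl Letter :=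
  ⟨ComplementState, Bool, inferInstance, inferInstance, complementPDA,
    Set.ext fun w => (complementPDA.mem_retLanguage_iff w).trans
      (complementPDA.headAccepts_iff w true)⟩

theorem compl_Lrep_mem_NrNIDPDAwtl : Lrepᶜ ∈ NrNIDPDAwtl Letter :=
  ⟨ComplementState, Bool, inferInstance, inferInstance, complementPDA,
    Set.ext fun w => (complementPDA.mem_nonretLanguage_iff w).trans
      (complementPDA.headAccepts_iff w false)⟩

/-! ### Slot words and computations on slot counts. -/

/-- The word with `ν s` copies of the letter `c s` for each slot `s` with `i ≤ s < j`. -/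
def slotWord {A : Type} (c : ℕ → A) (ν : ℕ → ℕ) (i j : ℕ) : List A :=
  (List.Ico i j).flatMap fun s => List.replicate (ν s) (c s)

section slotWord

variable {A : Type} (c : ℕ → A) (ν : ℕ → ℕ)

@[simp] theorem slotWord_self (i : ℕ) : slotWord c ν i i = [] := by
  simp [slotWord]

theorem slotWord_append {i j k : ℕ} (hij : i ≤ j) (hjk : j ≤ k) :
    slotWord c ν i j ++ slotWord c ν j k = slotWord c ν i k := by
  rw [slotWord, slotWord, slotWord, ← List.Ico.append_consecutive hij hjk, List.flatMap_append]

theorem slotWord_eq_cons {i j : ℕ} (h : i < j) :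
    slotWord c ν i j = List.replicate (ν i) (c i) ++ slotWord c ν (i + 1) j := by
  rw [slotWord, slotWord, List.Ico.eq_cons h, List.flatMap_cons]

variable {c ν}

theorem slotWord_congr {μ : ℕ → ℕ} {i j : ℕ} (h : ∀ s, i ≤ s → s < j → ν s = μ s) :
    slotWord c ν i j = slotWord c μ i j := by
  have : ∀ s ∈ List.Ico i j, List.replicate (ν s) (c s) = List.replicate (μ s) (c s) :=
    fun s hs => by rw [h s (List.Ico.mem.1 hs).1 (List.Ico.mem.1 hs).2]
  rw [slotWord, slotWord, List.flatMap_def, List.flatMap_def, List.map_congr_left this]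

theorem forall_mem_slotWord {T : Set A} {i j : ℕ} :
    (∀ d ∈ slotWord c ν i j, d ∈ T) ↔ ∀ s, i ≤ s → s < j → ν s = 0 ∨ c s ∈ T := by
  simp only [slotWord, List.mem_flatMap, List.Ico.mem, List.mem_replicate]
  constructor
  · intro h s h1 h2
    by_cases hs : ν s = 0
    · exact .inl hs
    · exact .inr (h _ ⟨s, ⟨h1, h2⟩, hs, rfl⟩)
  · rintro h d ⟨s, ⟨h1, h2⟩, hs, rfl⟩
    exact (h s h1 h2).resolve_left hs

/-- The letters of a slot are alike, so a scan that reaches the slot stops at its first letter or at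
none; the rest is again a slot word with the head at the left end of a slot. -/
theorem slotWord_eq_read {i j s : ℕ} (his : i ≤ s) (hsj : s < j) (hs : 0 < ν s) :
    slotWord c ν i j = slotWord c ν i s ++
      c s :: slotWord c (Function.update ν s (ν s - 1)) s j := by
  rw [← slotWord_append c ν his hsj.le, slotWord_eq_cons c _ hsj, slotWord_eq_cons c _ hsj,
    Function.update_self, slotWord_congr (ν := Function.update ν s (ν s - 1)) (μ := ν) (i := s + 1)
      fun t ht _ => Function.update_of_ne (by omega) _ _]
  obtain ⟨k, hk⟩ : ∃ k, ν s = k + 1 := ⟨ν s - 1, by omega⟩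
  simp [hk, List.replicate_succ]

theorem slotWord_update_left {i s k : ℕ} :
    slotWord c (Function.update ν s k) i s = slotWord c ν i s :=
  slotWord_congr fun _ _ ht => Function.update_of_ne (by omega) _ _

/-- The first letter outside `T` of a slot word is the first letter of a slot. -/
theorem exists_slot_of_eq {T : Set A} {i j : ℕ} {x y : List A} {a : A}
    (h : slotWord c ν i j = x ++ a :: y) (hx : ∀ d ∈ x, d ∈ T) (ha : a ∉ T) :
    ∃ s, i ≤ s ∧ s < j ∧ 0 < ν s ∧ a = c s ∧ x = slotWord c ν i s ∧
      y = slotWord c (Function.update ν s (ν s - 1)) s j := by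
  classical
  have hex : ∃ s, i ≤ s ∧ s < j ∧ 0 < ν s ∧ c s ∉ T := by
    by_contra hcon
    push Not at hcon
    refine ha ((forall_mem_slotWord (c := c) (ν := ν) (i := i) (j := j)).2 (fun s h1 h2 => ?_) a
      (by simp [h]))
    by_cases hs : ν s = 0
    · exact .inl hs
    · exact .inr (hcon s h1 h2 (by omega))
  obtain ⟨h1, h2, h3, h4⟩ := Nat.find_spec hex
  set s := Nat.find hex with hs
  have hlt : ∀ d ∈ slotWord c ν i s, d ∈ T := by
    refine forall_mem_slotWord.2 fun t ht1 ht2 => ?_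
    have := Nat.find_min hex ht2
    by_contra hcon
    push Not at hcon
    exact this ⟨ht1, by omega, by omega, hcon.2⟩
  rw [slotWord_eq_read h1 h2 h3] at h
  -- The factorisation at the first letter outside `T` is unique.
  have huniq : ∀ (x₁ x₂ : List A) (a₁ a₂ : A) (y₁ y₂ : List A), (∀ d ∈ x₁, d ∈ T) →
      (∀ d ∈ x₂, d ∈ T) → a₁ ∉ T → a₂ ∉ T → x₁ ++ a₁ :: y₁ = x₂ ++ a₂ :: y₂ →
      x₁ = x₂ ∧ a₁ = a₂ ∧ y₁ = y₂ := by
    intro x₁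
    induction x₁ with
    | nil =>
      intro x₂ a₁ a₂ y₁ y₂ _ h2 h3 _ h
      cases x₂ with
      | nil => simpa using h
      | cons d x₂ =>
        simp only [List.nil_append, List.cons_append, List.cons.injEq] at h
        exact absurd (h2 d (by simp)) (h.1 ▸ h3)
    | cons e x₁ ih =>
      intro x₂ a₁ a₂ y₁ y₂ h1 h2 h3 h4 h
      cases x₂ with
      | nil =>
        simp only [List.nil_append, List.cons_append, List.cons.injEq] at h
        exact absurd (h1 e (by simp)) (h.1 ▸ h4)
      | cons d x₂ =>
        simp only [List.cons_append, List.cons.injEq] at h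
        obtain ⟨g1, g2⟩ := ih x₂ a₁ a₂ y₁ y₂ (fun d hd => h1 d (by simp [hd]))
          (fun d hd => h2 d (by simp [hd])) h3 h4 h.2
        exact ⟨by rw [h.1, g1], g2⟩
  obtain ⟨g1, g2, g3⟩ := huniq _ _ _ _ _ _ hlt hx h4 ha h
  exact ⟨s, h1, h2, h3, g2.symm, g1.symm, g3.symm⟩

end slotWord

/-- A configuration whose remaining input is a slot word, with the head at the left end of the
slot `zone`. -/
structure SlotConf (Q G : Type) where
  state : Q
  stack : List G
  zone : ℕ
  count : ℕ → ℕ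

namespace PDA

variable {A Q G : Type}

/-- The steps of `M` on slot words with `m` slots. -/
inductive SlotStep (M : PDA A Q G) (ret : Bool) (c : ℕ → A) (m : ℕ) :
    SlotConf Q G → SlotConf Q G → Prop
  | letter (q q' : Q) (γ γ' : List G) (z : ℕ) (ν : ℕ → ℕ) (s : ℕ) (hzs : z ≤ s) (hsm : s < m)
      (hs : 0 < ν s) (hx : ∀ t, z ≤ t → t < s → ν t = 0 ∨ c t ∈ M.τ q) (ha : c s ∉ M.τ q)
      (h : M.LetterMove q (c s) γ q' γ') :
      SlotStep M ret c m ⟨q, γ, z, ν⟩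
        ⟨q', γ', bif ret then 0 else s, Function.update ν s (ν s - 1)⟩
  | endmarker (q q' : Q) (γ : List G) (z : ℕ) (ν : ℕ → ℕ)
      (hx : ∀ t, z ≤ t → t < m → ν t = 0 ∨ c t ∈ M.τ q) (h : M.EndMove q γ q') :
      SlotStep M ret c m ⟨q, γ, z, ν⟩ ⟨q', γ, 0, ν⟩

/-- The next step of `M` on a slot word may accept. -/
def SlotAccepting (M : PDA A Q G) (c : ℕ → A) (m : ℕ) (d : SlotConf Q G) : Prop :=
  (∃ s, d.zone ≤ s ∧ s < m ∧ 0 < d.count s ∧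
    (∀ t, d.zone ≤ t → t < s → d.count t = 0 ∨ c t ∈ M.τ d.state) ∧ c s ∉ M.τ d.state ∧
    M.LetterAccept d.state (c s) d.stack) ∨
  ((∀ t, d.zone ≤ t → t < m → d.count t = 0 ∨ c t ∈ M.τ d.state) ∧
    M.EndAccept d.state d.stack)

/-- Some computation of `M` on a slot word accepts. -/
def SlotAccepts (M : PDA A Q G) (ret : Bool) (c : ℕ → A) (m : ℕ) (d : SlotConf Q G) : Prop :=
  ∃ e, Relation.ReflTransGen (M.SlotStep ret c m) d e ∧ M.SlotAccepting c m e

end PDA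

namespace SlotConf

variable {A Q G : Type}

/-- The configuration with an explicit remaining input. -/
def toHeadConf (c : ℕ → A) (m : ℕ) (d : SlotConf Q G) : HeadConf A Q G :=
  ⟨slotWord c d.count 0 d.zone, d.state, slotWord c d.count d.zone m, d.stack⟩

/-- The head is in the given range, and at the left end in the returning mode. -/
def Valid (ret : Bool) (m : ℕ) (d : SlotConf Q G) : Prop :=
  d.zone ≤ m ∧ (ret = true → d.zone = 0)

end SlotConf

namespace PDA

variable {A Q G : Type} {M : PDA A Q G} {ret : Bool} {c : ℕ → A} {m : ℕ}

theorem SlotStep.valid {d e : SlotConf Q G} (h : M.SlotStep ret c m d e) : e.Valid ret m := by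
  cases h with
  | letter => cases ret <;> (simp [SlotConf.Valid]; try omega)
  | endmarker => simp [SlotConf.Valid]

theorem letter_conf_eq {z s : ℕ} {ν : ℕ → ℕ} (hzs : z ≤ s)
    (hsm : s < m) (q' : Q) (γ' : List G) :
    (⟨bif ret then [] else slotWord c ν 0 z ++ slotWord c ν z s, q',
      bif ret then slotWord c ν 0 z ++ slotWord c ν z s ++
        slotWord c (Function.update ν s (ν s - 1)) s m
      else slotWord c (Function.update ν s (ν s - 1)) s m, γ'⟩ : HeadConf A Q G) =
    SlotConf.toHeadConf c m ⟨q', γ', bif ret then 0 else s,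
      Function.update ν s (ν s - 1)⟩ := by
  rw [slotWord_append c _ (Nat.zero_le _) hzs]
  cases ret
  · simp [SlotConf.toHeadConf, slotWord_update_left]
  · simp only [cond_true, SlotConf.toHeadConf, slotWord_self]
    rw [← slotWord_append c (Function.update ν s (ν s - 1)) (Nat.zero_le s) hsm.le,
      slotWord_update_left]

theorem SlotStep.toHeadStep {d e : SlotConf Q G} (h : M.SlotStep ret c m d e)
    (hd : d.Valid ret m) : M.HeadStep ret (d.toHeadConf c m) (e.toHeadConf c m) := by
  cases h with
  | letter q q' γ γ' z ν s hzs hsm hs hx ha h =>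
    rw [← letter_conf_eq hzs hsm]
    simp only [SlotConf.toHeadConf]
    rw [slotWord_eq_read hzs hsm hs]
    exact .letter _ _ _ _ _ _ _ _ (forall_mem_slotWord.2 hx) ha h
  | endmarker q q' γ z ν hx h =>
    have := HeadStep.endmarker (M := M) (ret := ret) (slotWord c ν 0 z) q q' (slotWord c ν z m) γ
      (forall_mem_slotWord.2 hx) h
    rwa [slotWord_append c _ (Nat.zero_le _) hd.1] at this

theorem SlotStep.of_headStep {d : SlotConf Q G} {e : HeadConf A Q G}
    (h : M.HeadStep ret (d.toHeadConf c m) e) (hd : d.Valid ret m) :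
    ∃ e', e = e'.toHeadConf c m ∧ M.SlotStep ret c m d e' := by
  generalize hd' : d.toHeadConf c m = d' at h
  cases h with
  | letter u q q' x y a γ γ' hx ha h =>
    obtain ⟨q₀, γ₀, z, ν⟩ := d
    simp only [SlotConf.toHeadConf, HeadConf.mk.injEq] at hd'
    obtain ⟨rfl, rfl, hw, rfl⟩ := hd'
    obtain ⟨s, h1, h2, h3, rfl, rfl, rfl⟩ := exists_slot_of_eq hw hx ha
    exact ⟨_, letter_conf_eq h1 h2 _ _,
      .letter _ _ _ _ _ _ _ h1 h2 h3 (forall_mem_slotWord.1 hx) ha h⟩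
  | endmarker u q q' x γ hx h =>
    obtain ⟨q₀, γ₀, z, ν⟩ := d
    simp only [SlotConf.toHeadConf, HeadConf.mk.injEq] at hd'
    obtain ⟨rfl, rfl, rfl, rfl⟩ := hd'
    refine ⟨⟨q', γ₀, 0, ν⟩, ?_, .endmarker _ _ _ _ _ (forall_mem_slotWord.1 hx) h⟩
    simp [SlotConf.toHeadConf, slotWord_append c ν (Nat.zero_le z) hd.1]

theorem headAccepting_toHeadConf_iff (d : SlotConf Q G) :
    M.HeadAccepting (d.toHeadConf c m) ↔ M.SlotAccepting c m d := by
  refine or_congr ⟨?_, ?_⟩ (and_congr_left' forall_mem_slotWord)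
  · rintro ⟨x, a, y, hw, hx, ha, h⟩
    obtain ⟨s, h1, h2, h3, rfl, rfl, -⟩ := exists_slot_of_eq hw hx ha
    exact ⟨s, h1, h2, h3, forall_mem_slotWord.1 hx, ha, h⟩
  · rintro ⟨s, h1, h2, h3, hx, ha, h⟩
    exact ⟨_, _, _, slotWord_eq_read h1 h2 h3, forall_mem_slotWord.2 hx, ha, h⟩

theorem headAccepts_toHeadConf_iff {d : SlotConf Q G} (hd : d.Valid ret m) :
    M.HeadAccepts ret (d.toHeadConf c m) ↔ M.SlotAccepts ret c m d := by
  constructor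
  · rintro ⟨e, h1, h2⟩
    have : ∃ e', e = e'.toHeadConf c m ∧ Relation.ReflTransGen (M.SlotStep ret c m) d e' ∧
        e'.Valid ret m := by
      clear h2
      induction h1 with
      | refl => exact ⟨d, rfl, .refl, hd⟩
      | tail _ hs ih =>
        obtain ⟨f, rfl, h1, h2⟩ := ih
        obtain ⟨e', rfl, h3⟩ := SlotStep.of_headStep hs h2
        exact ⟨e', rfl, h1.tail h3, h3.valid⟩
    obtain ⟨e', rfl, h3, -⟩ := this
    exact ⟨e', h3, (headAccepting_toHeadConf_iff e').1 h2⟩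
  · rintro ⟨e, h1, h2⟩
    have : Relation.ReflTransGen (M.HeadStep ret) (d.toHeadConf c m) (e.toHeadConf c m) ∧
        e.Valid ret m := by
      clear h2
      induction h1 with
      | refl => exact ⟨.refl, hd⟩
      | tail _ hs ih => exact ⟨ih.1.tail (hs.toHeadStep ih.2), hs.valid⟩
    exact ⟨_, this.1, (headAccepting_toHeadConf_iff e).2 h2⟩

end PDA

/-! ### Replaying and cutting out parts of computations. -/

/-- The change of the height of a nonempty pushdown store. -/
def Action.height : Action → ℤ
  | .push => 1
  | .pop => -1
  | .neutral => 0

theorem head?_append_congr {G : Type} {β β' : List G} (h : β'.head? = β.head?) (α : List G) :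
    (α ++ β').head? = (α ++ β).head? := by
  cases α <;> simp [h]

namespace PDA

variable {A Q G : Type} {M : PDA A Q G} {ret : Bool} {c : ℕ → A} {m : ℕ}

theorem LetterMove.length_le {q q' : Q} {a : A} {γ γ' : List G}
    (h : M.LetterMove q a γ q' γ') : γ'.length ≤ γ.length + 1 := by
  rcases h with ⟨-, S, z, -, -, rfl⟩ | ⟨-, S, -, -, rfl⟩ | ⟨-, S, -, -, rfl⟩ <;> simp
  omega

theorem LetterMove.le_length {q q' : Q} {a : A} {γ γ' : List G}
    (h : M.LetterMove q a γ q' γ') : γ.length ≤ γ'.length + 1 := by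
  rcases h with ⟨-, S, z, -, -, rfl⟩ | ⟨-, S, -, -, rfl⟩ | ⟨-, S, -, -, rfl⟩ <;> simp <;> omega

/-- Input-drivenness: the height change depends on the letter alone. The only exception is a pop on
`⊥`, where the stack is empty before and after. -/
theorem LetterMove.length_eq {q q' : Q} {a : A} {γ γ' : List G}
    (h : M.LetterMove q a γ q' γ') (hne : 0 < γ.length ∨ 0 < γ'.length) :
    (γ'.length : ℤ) = γ.length + (M.sig a).height := by
  rcases h with ⟨h, S, z, -, -, rfl⟩ | ⟨h, S, -, -, rfl⟩ | ⟨h, S, -, -, rfl⟩ <;>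
    simp only [h, Action.height, List.length_cons, List.length_tail] at hne ⊢ <;> omega

theorem LetterMove.rebase {q q' : Q} {a : A} {α β β' γ' : List G}
    (h : M.LetterMove q a (α ++ β) q' γ') (hlen : β.length ≤ γ'.length)
    (hβ : β'.head? = β.head?) :
    ∃ α', γ' = α' ++ β ∧ M.LetterMove q a (α ++ β') q' (α' ++ β') := by
  have hh := head?_append_congr hβ α
  rcases h with ⟨h, S, z, hδ, hS, rfl⟩ | ⟨h, S, hδ, hS, rfl⟩ | ⟨h, S, hδ, hS, rfl⟩
  · exact ⟨z :: α, rfl, .inl ⟨h, S, z, hh ▸ hδ, hS, rfl⟩⟩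
  · refine ⟨α.tail, ?_, .inr (.inl ⟨h, S, hh ▸ hδ, hS, ?_⟩)⟩
    all_goals
      rcases α with _ | ⟨z, α⟩
      · rcases β with _ | ⟨y, β⟩
        · rcases β' with _ | ⟨y, β'⟩
          · rfl
          · simp at hβ
        · simp at hlen
      · rfl
  · exact ⟨α, rfl, .inr (.inr ⟨h, S, hh ▸ hδ, hS, rfl⟩)⟩

theorem SlotStep.count_le {d e : SlotConf Q G} (h : M.SlotStep ret c m d e) (i : ℕ) :
    e.count i ≤ d.count i := by
  cases h with
  | letter q q' γ γ' z ν s =>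
    by_cases ht : i = s
    · subst ht; simp
    · simp [Function.update_of_ne ht]
  | endmarker => exact le_rfl

theorem SlotStep.length_le {d e : SlotConf Q G} (h : M.SlotStep ret c m d e) :
    e.stack.length ≤ d.stack.length + 1 := by
  cases h with
  | letter _ _ _ _ _ _ _ _ _ _ _ _ h => exact h.length_le
  | endmarker => simp

theorem SlotStep.le_length {d e : SlotConf Q G} (h : M.SlotStep ret c m d e) :
    d.stack.length ≤ e.stack.length + 1 := by
  cases h with
  | letter _ _ _ _ _ _ _ _ _ _ _ _ h => exact h.le_length
  | endmarker => simp

/-- A step can be replayed on other letter counts, as long as no slot becomes nonempty, and on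
another stack bottom with the same top. -/
theorem SlotStep.replay {d e : SlotConf Q G} (h : M.SlotStep ret c m d e) {α β β' : List G}
    (hd : d.stack = α ++ β) (hlen : β.length ≤ e.stack.length) (hβ : β'.head? = β.head?) :
    ∃ α', e.stack = α' ++ β ∧ ∀ μ : ℕ → ℕ, (∀ s, e.count s = 0 → μ s = 0) →
      M.SlotStep ret c m ⟨d.state, α ++ β', d.zone, μ + (d.count - e.count)⟩
        ⟨e.state, α' ++ β', e.zone, μ⟩ := by
  cases h with
  | letter q q' γ γ' z ν s hzs hsm hs hx ha h =>
    obtain rfl : γ = α ++ β := hd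
    obtain ⟨α', hα', h'⟩ := h.rebase hlen hβ
    refine ⟨α', hα', fun μ hμ => ?_⟩
    -- The replay is parametrised by the counts after the step; before it there is one more letter
    -- in slot `s`, which is therefore nonempty.
    have hμ' : μ = Function.update (μ + (ν - Function.update ν s (ν s - 1))) s
        ((μ + (ν - Function.update ν s (ν s - 1))) s - 1) := by
      funext t
      by_cases ht : t = s
      · subst ht
        simp
        omega
      · simp [Function.update_of_ne ht]
    conv => rhs; rw [hμ']
    refine .letter _ _ _ _ _ _ _ hzs hsm ?_ (fun t h1 h2 => (hx t h1 h2).imp_left ?_) ha h'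
    · simp
      omega
    · intro h0
      have hts : t ≠ s := by omega
      have := hμ t (by simp [Function.update_of_ne hts, h0])
      simp [this, Function.update_of_ne hts]
  | endmarker q q' γ z ν hx h =>
    obtain rfl : γ = α ++ β := hd
    refine ⟨α, rfl, fun μ hμ => ?_⟩
    simp only [tsub_self, add_zero]
    obtain ⟨S, hδ, hS⟩ := h
    exact .endmarker _ _ _ _ _ (fun t h1 h2 => (hx t h1 h2).imp_left (hμ t))
      ⟨S, by rw [head?_append_congr hβ]; exact hδ, hS⟩

theorem SlotAccepting.replay {q : Q} {α β β' : List G} {z : ℕ} {ν μ : ℕ → ℕ}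
    (h : M.SlotAccepting c m ⟨q, α ++ β, z, ν⟩) (hβ : β'.head? = β.head?)
    (hμ : ∀ s, ν s = 0 ↔ μ s = 0) : M.SlotAccepting c m ⟨q, α ++ β', z, μ⟩ := by
  have hh := head?_append_congr hβ α
  refine h.imp ?_ ?_
  · rintro ⟨s, h1, h2, h3, h4, h5, h6⟩
    refine ⟨s, h1, h2, ?_, fun t g1 g2 => (h4 t g1 g2).imp_left (hμ t).1, h5, ?_⟩
    · have := hμ s
      simp only at h3 ⊢
      omega
    · simpa only [LetterAccept, hh] using h6
  · rintro ⟨h1, h2⟩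
    exact ⟨fun t g1 g2 => (h1 t g1 g2).imp_left (hμ t).1, by simpa only [EndAccept, hh] using h2⟩

end PDA

theorem exists_nat_chain {X : Type} {r : X → X → Prop} {x y : X} (h : Relation.ReflTransGen r x y) :
    ∃ (f : ℕ → X) (N : ℕ), f 0 = x ∧ f N = y ∧ ∀ t < N, r (f t) (f (t + 1)) := by
  induction h using Relation.ReflTransGen.head_induction_on with
  | refl => exact ⟨fun _ => y, 0, rfl, rfl, by simp⟩
  | @head a b hab _ ih =>
    obtain ⟨f, N, h1, h2, h3⟩ := ih
    refine ⟨fun t => Nat.casesOn t a f, N + 1, rfl, h2, fun t ht => ?_⟩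
    cases t with
    | zero => simpa [h1] using hab
    | succ t => exact h3 t (by omega)

/-- Discrete intermediate values: rising by at most one per step, no level is jumped over. -/
theorem exists_last_at_height {h : ℕ → ℕ} {T ℓ : ℕ} (h0 : h 0 = 0)
    (hstep : ∀ t < T, h (t + 1) ≤ h t + 1) (hℓ : ℓ ≤ h T) :
    ∃ t ≤ T, h t = ℓ ∧ ∀ r, t < r → r ≤ T → ℓ < h r := by
  induction T with
  | zero => exact ⟨0, le_rfl, by omega, by omega⟩
  | succ T ih =>
    by_cases heq : ℓ = h (T + 1)
    · exact ⟨T + 1, le_rfl, heq.symm, by omega⟩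
    · have := hstep T (by omega)
      obtain ⟨t, h1, h2, h3⟩ := ih (fun t ht => hstep t (by omega)) (by omega)
      refine ⟨t, by omega, h2, fun r hr hrT => ?_⟩
      rcases Nat.lt_or_ge r (T + 1) with hlt | hge
      · exact h3 r hr (by omega)
      · obtain rfl : r = T + 1 := by omega
        omega

theorem exists_first_at_height {h : ℕ → ℕ} {T N ℓ : ℕ} (hTN : T ≤ N)
    (hstep : ∀ t < N, h t ≤ h (t + 1) + 1) (hℓ : ℓ ≤ h T) :
    (∃ s, T ≤ s ∧ s ≤ N ∧ h s = ℓ ∧ ∀ r, T ≤ r → r < s → ℓ < h r) ∨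
      ∀ r, T ≤ r → r ≤ N → ℓ < h r := by
  induction N, hTN using Nat.le_induction with
  | base =>
    by_cases heq : h T = ℓ
    · exact .inl ⟨T, le_rfl, le_rfl, heq, by omega⟩
    · refine .inr fun r h1 h2 => ?_
      obtain rfl : r = T := by omega
      omega
  | succ N hTN ih =>
    rcases ih fun t ht => hstep t (by omega) with ⟨s, h1, h2, h3, h4⟩ | hall
    · exact .inl ⟨s, h1, by omega, h3, h4⟩
    · have h1 := hstep N (by omega)
      have h2 := hall N hTN le_rfl
      by_cases heq : h (N + 1) = ℓ
      · exact .inl ⟨N + 1, by omega, le_rfl, heq, fun r g1 g2 => hall r g1 (by omega)⟩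
      · refine .inr fun r g1 g2 => ?_
        rcases Nat.lt_or_ge r (N + 1) with hlt | hge
        · exact hall r g1 (by omega)
        · obtain rfl : r = N + 1 := by omega
          omega

namespace PDA

variable {A Q G : Type} {M : PDA A Q G} {ret : Bool} {c : ℕ → A} {m : ℕ}
  {f : ℕ → SlotConf Q G} {N : ℕ}

theorem count_antitone (hf : ∀ t < N, M.SlotStep ret c m (f t) (f (t + 1))) {s t : ℕ}
    (hst : s ≤ t) (ht : t ≤ N) (i : ℕ) : (f t).count i ≤ (f s).count i := by
  induction t, hst using Nat.le_induction with
  | base => exact le_rfl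
  | succ t _ ih => exact ((hf t (by omega)).count_le i).trans (ih (by omega))

theorem reflTransGen_of_chain (hf : ∀ t < N, M.SlotStep ret c m (f t) (f (t + 1))) {s t : ℕ}
    (hst : s ≤ t) (ht : t ≤ N) : Relation.ReflTransGen (M.SlotStep ret c m) (f s) (f t) := by
  induction t, hst using Nat.le_induction with
  | base => exact .refl
  | succ t _ ih => exact (ih (by omega)).tail (hf t (by omega))

/-- A part of a computation that stays above the stack bottom `β` can be replayed on other letter
counts, as long as no slot becomes nonempty, and on another stack bottom with the same top. -/
theorem replay (hf : ∀ t < N, M.SlotStep ret c m (f t) (f (t + 1))) {s t : ℕ}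
    (hst : s ≤ t) (ht : t ≤ N) {α β β' : List G} (hs : (f s).stack = α ++ β)
    (hlen : ∀ r, s ≤ r → r ≤ t → β.length ≤ (f r).stack.length) (hβ : β'.head? = β.head?) :
    ∃ α', (f t).stack = α' ++ β ∧ ∀ μ : ℕ → ℕ, (∀ i, (f t).count i = 0 → μ i = 0) →
      Relation.ReflTransGen (M.SlotStep ret c m)
        ⟨(f s).state, α ++ β', (f s).zone, μ + ((f s).count - (f t).count)⟩
        ⟨(f t).state, α' ++ β', (f t).zone, μ⟩ := by
  induction t, hst using Nat.le_induction with
  | base => exact ⟨α, hs, fun μ _ => by simp only [tsub_self, add_zero]; exact .refl⟩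
  | succ t hst ih =>
    obtain ⟨α₁, h1, h2⟩ := ih (by omega) fun r g1 g2 => hlen r g1 (by omega)
    obtain ⟨α₂, h3, h4⟩ := (hf t (by omega)).replay h1 (hlen _ (by omega) le_rfl) hβ
    refine ⟨α₂, h3, fun μ hμ => ?_⟩
    have hle := (hf t (by omega)).count_le
    have hle' := count_antitone hf hst (by omega)
    have h5 := h2 (μ + ((f t).count - (f (t + 1)).count)) fun i hi => by
      have := hle i
      simp [hi, hμ i (by omega)]
    have heq : μ + ((f t).count - (f (t + 1)).count) + ((f s).count - (f t).count) =
        μ + ((f s).count - (f (t + 1)).count) := by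
      funext i
      have := hle i
      have := hle' i
      simp only [Pi.add_apply, Pi.sub_apply]
      omega
    rw [heq] at h5
    exact h5.tail (h4 μ hμ)

/-- Two parts of an accepting computation between which the stack is not touched can be cut out. -/
theorem slotAccepts_of_excise (hf : ∀ t < N, M.SlotStep ret c m (f t) (f (t + 1)))
    (hacc : M.SlotAccepting c m (f N)) (h0 : (f 0).stack = []) {t₁ t₂ t₃ t₄ : ℕ}
    (h12 : t₁ ≤ t₂) (h23 : t₂ ≤ t₃) (h34 : t₃ ≤ t₄) (h4N : t₄ ≤ N)
    (hq : (f t₁).state = (f t₂).state) (hz : (f t₁).zone = (f t₂).zone)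
    (hγ : (f t₁).stack.head? = (f t₂).stack.head?)
    (hlen : ∀ r, t₂ ≤ r → r ≤ t₃ → (f t₂).stack.length ≤ (f r).stack.length)
    (hγ' : (f t₃).stack = (f t₂).stack)
    (hq' : (f t₃).state = (f t₄).state) (hz' : (f t₃).zone = (f t₄).zone)
    (hγ'' : (f t₄).stack = (f t₁).stack) :
    M.SlotAccepts ret c m ⟨(f 0).state, [], (f 0).zone,
      (f t₄).count + ((f t₂).count - (f t₃).count) + ((f 0).count - (f t₁).count)⟩ := by
  have a1 := count_antitone hf (s := 0) (Nat.zero_le t₁) (by omega)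
  have a2 := count_antitone hf h12 (by omega)
  have a3 := count_antitone hf h23 (by omega)
  have a4 := count_antitone hf h34 (by omega)
  obtain ⟨α, h1, h2⟩ := replay hf (Nat.zero_le t₁) (by omega) (α := []) (β := []) (β' := [])
    (by simpa using h0) (by simp) rfl
  obtain ⟨α', h3, h4⟩ := replay hf h23 (by omega) (α := []) (β := (f t₂).stack)
    (β' := (f t₁).stack) rfl hlen hγ
  obtain rfl : α' = [] := by simpa [hγ'] using h3
  obtain rfl : α = (f t₁).stack := by simpa using h1.symm
  -- The pieces are glued from the end: the middle part is replayed so as to finish with the counts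
  -- at `t₄`, and the initial part so as to finish where that replay begins.
  have g1 := h4 (f t₄).count fun i hi => by have := a4 i; omega
  have g2 := h2 ((f t₄).count + ((f t₂).count - (f t₃).count)) fun i hi => by
    have := a2 i; have := a3 i; have := a4 i
    simp only [Pi.add_apply, Pi.sub_apply]
    omega
  rw [← hq, ← hz, hq', hz'] at g1
  have g3 := g2.trans (by simpa using g1)
  refine ⟨f N, ?_, hacc⟩
  have g4 := reflTransGen_of_chain hf h4N le_rfl
  rw [← hγ''] at g3
  exact g3.trans g4

/-- A part of an accepting computation that leads to a stack bottom that is never touched can be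
cut out. -/
theorem slotAccepts_of_excise_of_never_popped
    (hf : ∀ t < N, M.SlotStep ret c m (f t) (f (t + 1)))
    (hacc : M.SlotAccepting c m (f N)) (h0 : (f 0).stack = []) {t₁ t₂ : ℕ}
    (h12 : t₁ ≤ t₂) (h2N : t₂ ≤ N)
    (hq : (f t₁).state = (f t₂).state) (hz : (f t₁).zone = (f t₂).zone)
    (hγ : (f t₁).stack.head? = (f t₂).stack.head?)
    (hlen : ∀ r, t₂ ≤ r → r ≤ N → (f t₂).stack.length ≤ (f r).stack.length) :
    M.SlotAccepts ret c m ⟨(f 0).state, [], (f 0).zone,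
      (f t₂).count + ((f 0).count - (f t₁).count)⟩ := by
  have a2 := count_antitone hf h12 (by omega)
  have a3 := count_antitone hf h2N le_rfl
  obtain ⟨α, h1, h2⟩ := replay hf (Nat.zero_le t₁) (by omega) (α := []) (β := []) (β' := [])
    (by simpa using h0) (by simp) rfl
  obtain ⟨α', h3, h4⟩ := replay hf h2N le_rfl (α := []) (β := (f t₂).stack)
    (β' := (f t₁).stack) rfl hlen hγ
  obtain rfl : α = (f t₁).stack := by simpa using h1.symm
  have g1 := h4 (f N).count fun i hi => hi
  have g2 := h2 (f t₂).count fun i hi => by have := a2 i; omega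
  have heq : (f N).count + ((f t₂).count - (f N).count) = (f t₂).count :=
    add_tsub_cancel_of_le (Pi.le_def.2 a3)
  rw [← hq, ← hz, heq] at g1
  refine ⟨_, g2.trans (by simpa using g1), SlotAccepting.replay (β := (f t₂).stack) ?_ hγ
    fun _ => Iff.rfl⟩
  rw [← h3]
  exact hacc

end PDA

/-! ### Accepting computations on `bⁿ#bⁿaⁿ`. -/

/-- The letters of the slots of the words `bⁱ#ʰbʲaˡ`. -/
def slotLetter : ℕ → Letter
  | 0 => .b
  | 1 => .hash
  | 2 => .b
  | _ => .a

theorem slotWord_slotLetter (ν : ℕ → ℕ) :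
    slotWord slotLetter ν 0 4 = List.replicate (ν 0) .b ++ (List.replicate (ν 1) .hash ++
      (List.replicate (ν 2) .b ++ List.replicate (ν 3) .a)) := by
  rw [slotWord_eq_cons _ _ (by omega), slotWord_eq_cons _ _ (by omega),
    slotWord_eq_cons _ _ (by omega), slotWord_eq_cons _ _ (by omega), slotWord_self]
  simp [slotLetter]

theorem replicate_append_hash_inj {i j k l : ℕ}
    (h : List.replicate i Letter.b ++ Letter.hash :: List.replicate j Letter.b =
      List.replicate k Letter.b ++ Letter.hash :: List.replicate l Letter.b) : i = k ∧ j = l := by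
  induction i generalizing k with
  | zero =>
    cases k with
    | zero => simpa using h
    | succ k => simp [List.replicate_succ] at h
  | succ i ih =>
    cases k with
    | zero => simp [List.replicate_succ] at h
    | succ k =>
      simp only [List.replicate_succ, List.cons_append, List.cons.injEq, true_and] at h
      obtain ⟨rfl, rfl⟩ := ih h
      exact ⟨rfl, rfl⟩

theorem count_hash_repWord (n k : ℕ) : (repWord n k).count .hash = k := by
  induction k with
  | zero => simp [repWord, List.count_replicate]
  | succ k ih =>
    simp only [repWord, List.count_append, List.replicate_succ, List.flatten_cons,
      List.count_cons_self, List.count_replicate] at ih ⊢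
    simp at ih ⊢
    omega

theorem slotWord_mem_Lrep_iff {ν : ℕ → ℕ} (h1 : ν 1 = 1) :
    slotWord slotLetter ν 0 4 ∈ Lrep ↔ 1 ≤ ν 0 ∧ ν 0 = ν 2 ∧ ν 2 = ν 3 := by
  have h2 : eraseA (slotWord slotLetter ν 0 4) =
      List.replicate (ν 0) .b ++ .hash :: List.replicate (ν 2) .b := by
    rw [slotWord_slotLetter, h1]
    simp [eraseA]
  have h3 : (slotWord slotLetter ν 0 4).count .a = ν 3 := by
    rw [slotWord_slotLetter]
    simp [List.count_replicate]
  rw [mem_Lrep_iff, h2, h3]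
  constructor
  · rintro ⟨n, k, hn, h4, rfl⟩
    have h5 := congrArg (List.count Letter.hash) h4
    rw [count_hash_repWord] at h5
    obtain rfl : k = 1 := by simpa [List.count_replicate] using h5.symm
    obtain ⟨h6, h7⟩ := replicate_append_hash_inj (k := ν 3) (l := ν 3)
      (h4.trans (by simp [repWord]))
    omega
  · rintro ⟨h4, h5, h6⟩
    exact ⟨ν 0, 1, h4, by simp [repWord, h5], by omega⟩

/-- Everything about a configuration that is needed to cut out a part of a computation: state,
stack top, head position, and which of the slots of letters `b` and `#` are empty. -/
def SlotConf.profile {Q G : Type} (d : SlotConf Q G) :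
    (Q × Option G) × Fin 4 × (Fin 3 → Bool) :=
  ((d.state, d.stack.head?), Fin.ofNat 4 d.zone, fun s => decide (d.count s = 0))

theorem SlotConf.profile_eq {Q G : Type} {d e : SlotConf Q G} (h : d.profile = e.profile)
    (hd : d.zone < 4) (he : e.zone < 4) : d.state = e.state ∧ d.stack.head? = e.stack.head? ∧
      d.zone = e.zone ∧ ∀ s < 3, d.count s = 0 ↔ e.count s = 0 := by
  simp only [profile, Prod.mk.injEq] at h
  obtain ⟨⟨h1, h2⟩, h3, h4⟩ := h
  refine ⟨h1, h2, ?_, fun s hs => by simpa using congrFun h4 ⟨s, hs⟩⟩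
  have := congrArg Fin.val h3
  simpa [Fin.ofNat, Nat.mod_eq_of_lt hd, Nat.mod_eq_of_lt he] using this

/-- An accepting computation of `M` on the word `bⁿ#bⁿaⁿ`, where `M` accepts no word `bⁱ#bʲaˡ`
other than those with `i = j = l`. -/
structure RepRun {Q G : Type} (M : PDA Letter Q G) (ret : Bool) (n : ℕ)
    (f : ℕ → SlotConf Q G) (N : ℕ) : Prop where
  stack_zero : (f 0).stack = []
  zone_zero : (f 0).zone = 0
  count_one : (f 0).count 1 = 1
  count_eq : ∀ s, s ≠ 1 → (f 0).count s = n
  step : ∀ t < N, M.SlotStep ret slotLetter 4 (f t) (f (t + 1))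
  accepting : M.SlotAccepting slotLetter 4 (f N)
  eq_of_accepts : ∀ ν : ℕ → ℕ, ν 1 = 1 →
    M.SlotAccepts ret slotLetter 4 ⟨(f 0).state, [], (f 0).zone, ν⟩ → ν 0 = ν 2 ∧ ν 2 = ν 3

/-- The height of the stack plus its change if all remaining letters were read. -/
def potential {Q G : Type} (M : PDA Letter Q G) (d : SlotConf Q G) : ℤ :=
  d.stack.length + (M.sig .b).height * (d.count 0 + d.count 2) +
    (M.sig .hash).height * d.count 1 + (M.sig .a).height * d.count 3

theorem potential_eq_of_step {Q G : Type} {M : PDA Letter Q G} {ret : Bool} {d e : SlotConf Q G}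
    (h : M.SlotStep ret slotLetter 4 d e) (hne : 0 < d.stack.length ∨ 0 < e.stack.length) :
    potential M e = potential M d := by
  cases h with
  | letter q q' γ γ' z ν s hzs hsm hs hx ha h =>
    have h1 := h.length_eq hne
    have h2 : ((ν s - 1 : ℕ) : ℤ) = ν s - 1 := by omega
    simp only [potential]
    rw [h1]
    interval_cases s <;> simp only [Function.update_self, ne_eq, OfNat.ofNat_ne_zero,
      not_false_eq_true, Function.update_of_ne, h2, slotLetter, OfNat.ofNat_ne_one,
      OfNat.zero_ne_ofNat, one_ne_zero, zero_ne_one, OfNat.one_ne_ofNat, Nat.reduceEqDiff] <;> ring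
  | endmarker => rfl

namespace RepRun

variable {Q G : Type} {M : PDA Letter Q G} {ret : Bool} {n : ℕ} {f : ℕ → SlotConf Q G} {N : ℕ}

theorem slotAccepts (h : RepRun M ret n f N) {t : ℕ} (ht : t ≤ N) :
    M.SlotAccepts ret slotLetter 4 (f t) :=
  ⟨f N, PDA.reflTransGen_of_chain h.step ht le_rfl, h.accepting⟩

theorem count_le (h : RepRun M ret n f N) {s t : ℕ} (hst : s ≤ t) (ht : t ≤ N) (i : ℕ) :
    (f t).count i ≤ (f s).count i :=
  PDA.count_antitone h.step hst ht i

theorem zone_lt (h : RepRun M ret n f N) {t : ℕ} (ht : t ≤ N) :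
    (f t).zone < 4 ∧ (f t).Valid ret 4 := by
  cases t with
  | zero => simp [h.zone_zero, SlotConf.Valid]
  | succ t =>
    have hs := h.step t (by omega)
    refine ⟨?_, hs.valid⟩
    generalize f t = d at hs
    generalize f (t + 1) = e at hs ⊢
    cases hs with
    | letter => cases ret <;> (simp; try omega)
    | endmarker => simp

/-- As long as `#` has not been read, a `b` of the second block is read only if the first block
has been read completely. -/
theorem first_block_first (h : RepRun M ret n f N) {t : ℕ} (ht : t ≤ N)
    (h1 : (f t).count 1 ≠ 0) :
    (f t).zone ≠ 1 ∧ ((f t).zone = 2 ∨ (f t).count 2 ≠ n → (f t).count 0 = 0) := by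
  induction t with
  | zero => simp [h.zone_zero, h.count_eq]
  | succ t ih =>
    have hs := h.step t (by omega)
    have hle := h.count_le (Nat.le_add_right t 1) ht 1
    have ih := ih (by omega) (by omega)
    have hone := h.count_le (Nat.zero_le t) (by omega) 1
    rw [h.count_one] at hone
    generalize f t = d at hs ih hle hone
    generalize f (t + 1) = e at hs h1 hle ⊢
    cases hs with
    | letter q q' γ γ' z ν s hzs hsm hs hx ha hm =>
      simp only at *
      have hs1 : s ≠ 1 := by
        rintro rfl
        simp at h1
        omega
      -- Both blocks consist of the same letter, so from the left end a scan that stops at a `b` of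
      -- the second block would have stopped in a nonempty first block.
      have h2 : s = 2 → ν 0 = 0 := by
        rintro rfl
        by_cases hz : z = 0
        · refine (hx 0 (by omega) (by omega)).resolve_right ?_
          simpa [slotLetter] using ha
        · exact ih.2 (.inl (by omega))
      refine ⟨by cases ret <;> (simp; try omega), fun hor => ?_⟩
      interval_cases s
      · have hor : ν 2 ≠ n := by
          rcases hor with hor | hor
          · cases ret <;> simp at hor
          · simpa using hor
        have := ih.2 (.inr hor)
        simp [this]
      · exact absurd rfl hs1
      · simpa using h2 rfl
      · have hor : ν 2 ≠ n := by
          rcases hor with hor | hor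
          · cases ret <;> simp at hor
          · simpa using hor
        simpa using ih.2 (.inr hor)
    | endmarker q q' γ z ν hx hm =>
      simp only at *
      exact ⟨by simp, fun hor => ih.2 (.inr (by simpa using hor))⟩

/-- Once `#` has been read while letters `b` remain in both blocks, the head is between the two
blocks: otherwise the boundary of the blocks would be lost. -/
theorem zone_of_hash_read (h : RepRun M ret n f N) {t : ℕ} (ht : t ≤ N)
    (h0 : (f t).count 0 ≠ 0) (h1 : (f t).count 1 = 0) (h2 : (f t).count 2 ≠ 0) :
    (f t).zone = 1 ∨ (f t).zone = 2 := by
  by_contra hz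
  have hlt := h.zone_lt ht
  have hz : (f t).zone = 0 ∨ (f t).zone = 3 := by omega
  -- One `b` is moved from the second block to the first.
  set μ := Function.update (Function.update (f t).count 0 ((f t).count 0 + 1)) 2
    ((f t).count 2 - 1) with hμ
  have m0 : μ 0 = (f t).count 0 + 1 := by simp [hμ]
  have m1 : μ 1 = (f t).count 1 := by simp [hμ]
  have m2 : μ 2 = (f t).count 2 - 1 := by simp [hμ]
  have m3 : ∀ s, 3 ≤ s → μ s = (f t).count s := fun s hs => by
    rw [hμ, Function.update_of_ne (by omega), Function.update_of_ne (by omega)]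
  obtain ⟨α, g1, g2⟩ := PDA.replay h.step (Nat.zero_le t) ht (α := []) (β := []) (β' := [])
    (by simpa using h.stack_zero) (by simp) rfl
  simp only [List.append_nil] at g2
  have g3 := g2 μ fun i hi => by
    rcases Nat.lt_or_ge i 3 with hi3 | hi3
    · interval_cases i <;> omega
    · rw [m3 i hi3, hi]
  have hb : List.replicate (μ 0) Letter.b ++ List.replicate (μ 2) Letter.b =
      List.replicate ((f t).count 0) Letter.b ++ List.replicate ((f t).count 2) Letter.b := by
    rw [List.replicate_append_replicate, List.replicate_append_replicate]
    congr 1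
    omega
  -- Neither `#` nor the head separates the blocks any more, so only the total number of letters `b`
  -- is visible.
  have hw : SlotConf.toHeadConf slotLetter 4 ⟨(f t).state, α, (f t).zone, μ⟩ =
      (f t).toHeadConf slotLetter 4 := by
    have h4 : slotWord slotLetter μ 0 3 = slotWord slotLetter (f t).count 0 3 := by
      rw [slotWord_eq_cons _ _ (by omega), slotWord_eq_cons _ _ (by omega),
        slotWord_eq_cons _ _ (by omega), slotWord_self, slotWord_eq_cons _ _ (by omega),
        slotWord_eq_cons _ _ (by omega), slotWord_eq_cons _ _ (by omega), slotWord_self, m1, h1]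
      simpa [slotLetter] using hb
    have h5 : slotWord slotLetter μ 3 4 = slotWord slotLetter (f t).count 3 4 :=
      slotWord_congr fun s hs _ => m3 s hs
    have h6 : α = (f t).stack := by simpa using g1.symm
    rcases hz with hz | hz
    · simp only [SlotConf.toHeadConf, hz, slotWord_self, h6,
        ← slotWord_append slotLetter _ (show 0 ≤ 3 by omega) (show 3 ≤ 4 by omega), h4, h5]
    · simp only [SlotConf.toHeadConf, hz, h4, h5, h6]
  have hacc := (PDA.headAccepts_toHeadConf_iff hlt.2).2 (h.slotAccepts ht)
  rw [← hw] at hacc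
  obtain ⟨e, g4, g5⟩ := (PDA.headAccepts_toHeadConf_iff
    (d := ⟨(f t).state, α, (f t).zone, μ⟩) hlt.2).1 hacc
  -- Thus `bⁿ⁺¹#bⁿ⁻¹aⁿ` would be accepted.
  have g6 := h.eq_of_accepts (μ + ((f 0).count - (f t).count))
    (by simp [m1, h1, h.count_one]) ⟨e, g3.trans g4, g5⟩
  have c0 := h.count_le (Nat.zero_le t) ht 0
  have c2 := h.count_le (Nat.zero_le t) ht 2
  simp only [Pi.add_apply, Pi.sub_apply, m0, m2] at g6
  rw [h.count_eq 0 (by simp)] at g6 c0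
  rw [h.count_eq 2 (by simp)] at g6 c2
  omega

/-- Between two times at which the same slots are empty, letters `b` of at most one block are read. -/
theorem count_eq_or_count_eq (h : RepRun M ret n f N) {s t : ℕ} (hst : s ≤ t) (ht : t ≤ N)
    (he : ∀ i < 3, (f s).count i = 0 ↔ (f t).count i = 0) :
    (f s).count 0 = (f t).count 0 ∨ (f s).count 2 = (f t).count 2 := by
  by_cases h0 : (f t).count 0 = 0
  · exact .inl (((he 0 (by omega)).2 h0).trans h0.symm)
  by_cases h2 : (f t).count 2 = 0
  · exact .inr (((he 2 (by omega)).2 h2).trans h2.symm)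
  by_cases h1 : (f t).count 1 = 0
  · have hs1 := (he 1 (by omega)).2 h1
    -- While letters `b` remain in both blocks, the head stays right of the first one, which is
    -- therefore not read.
    refine .inl ?_
    clear he
    induction t, hst using Nat.le_induction with
    | base => rfl
    | succ t hst ih =>
      have l0 := h.count_le (Nat.le_add_right t 1) ht 0
      have l2 := h.count_le (Nat.le_add_right t 1) ht 2
      have l1 := h.count_le hst (by omega) 1
      have ht1 : (f t).count 1 = 0 := by omega
      rw [ih (by omega) (by omega) (by omega) ht1]
      have hzone := h.zone_of_hash_read (by omega) (t := t) (by omega) ht1 (by omega)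
      have hs := h.step t (by omega)
      generalize f t = d at hs hzone ⊢
      generalize f (t + 1) = e at hs ⊢
      cases hs with
      | letter q q' γ γ' z ν i hzi =>
        simp only at hzone ⊢
        rw [Function.update_of_ne (by omega)]
      | endmarker => rfl
  · have hs1 : (f s).count 1 ≠ 0 := fun h' => h1 ((he 1 (by omega)).1 h')
    have hs0 : (f s).count 0 ≠ 0 := fun h' => h0 ((he 0 (by omega)).1 h')
    -- The first block is nonempty at both times, so the second one still has all `n` letters at
    -- both.
    have g1 := (h.first_block_first ht h1).2
    have g2 := (h.first_block_first (hst.trans ht) hs1).2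
    refine .inr ?_
    by_contra hne
    by_cases hn : (f t).count 2 = n
    · exact hs0 (g2 (.inr (by omega)))
    · exact h0 (g1 (.inr hn))

theorem count_one_eq (h : RepRun M ret n f N) {s t : ℕ} (hst : s ≤ t) (ht : t ≤ N)
    (he : ∀ i < 3, (f s).count i = 0 ↔ (f t).count i = 0) : (f s).count 1 = (f t).count 1 := by
  have h1 := h.count_le hst ht 1
  have h2 := h.count_le (Nat.zero_le s) (hst.trans ht) 1
  have h3 := he 1 (by omega)
  rw [h.count_one] at h2
  omega

/-- The cut must remove equally many letters from both blocks and from the letters `a`. As one block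
loses nothing, none of them does. -/
theorem count_eq_of_excise_one (h : RepRun M ret n f N) {s t : ℕ} (hst : s ≤ t) (ht : t ≤ N)
    (he : ∀ i < 3, (f s).count i = 0 ↔ (f t).count i = 0)
    (hacc : M.SlotAccepts ret slotLetter 4
      ⟨(f 0).state, [], (f 0).zone, (f t).count + ((f 0).count - (f s).count)⟩) :
    ∀ i < 4, (f s).count i = (f t).count i := by
  have h1 := h.count_one_eq hst ht he
  have c1 := h.count_le (Nat.zero_le s) (hst.trans ht) 1
  have key := h.eq_of_accepts _ (by
    simp only [Pi.add_apply, Pi.sub_apply]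
    rw [h.count_one] at c1 ⊢
    omega) hacc
  have hor := h.count_eq_or_count_eq hst ht he
  have a0 := h.count_le hst ht 0
  have a2 := h.count_le hst ht 2
  have a3 := h.count_le hst ht 3
  have c0 := h.count_le (Nat.zero_le s) (hst.trans ht) 0
  have c2 := h.count_le (Nat.zero_le s) (hst.trans ht) 2
  have c3 := h.count_le (Nat.zero_le s) (hst.trans ht) 3
  simp only [Pi.add_apply, Pi.sub_apply] at key
  rw [h.count_eq 0 (by simp)] at key c0
  rw [h.count_eq 2 (by simp)] at key c2
  rw [h.count_eq 3 (by simp)] at key c3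
  intro i hi
  interval_cases i <;> omega

theorem potential_eq (h : RepRun M ret n f N) {s t : ℕ} (hst : s ≤ t) (ht : t ≤ N)
    (hpos : ∀ r, s ≤ r → r < t → 0 < (f r).stack.length ∨ 0 < (f (r + 1)).stack.length) :
    potential M (f t) = potential M (f s) := by
  induction t, hst using Nat.le_induction with
  | base => rfl
  | succ t hst ih =>
    rw [potential_eq_of_step (h.step t (by omega)) (hpos t hst (by omega)),
      ih (by omega) fun r h1 h2 => hpos r h1 (by omega)]

/-! ### The bound on the stack height. -/

/-- The heights of the stack in a computation are bounded independently of `n`. -/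
theorem length_stack_le [Finite Q] [Finite G] (h : RepRun M ret n f N) {T : ℕ} (hT : T ≤ N) :
    (f T).stack.length ≤ Nat.card (((Q × Option G) × Fin 4 × (Fin 3 → Bool)) ×
      Option ((Q × Option G) × Fin 4 × (Fin 3 → Bool))) := by
  by_contra! hlt
  set K := Nat.card (((Q × Option G) × Fin 4 × (Fin 3 → Bool)) ×
      Option ((Q × Option G) × Fin 4 × (Fin 3 → Bool))) with hK
  -- Each level is labelled by the profile at its last visit before `T` and the profile at its first
  -- visit after `T`, with `none` if the level is not reached again.
  have key : ∀ ℓ : Fin (K + 1), ∃ p : ((Q × Option G) × Fin 4 × (Fin 3 → Bool)) ×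
      Option ((Q × Option G) × Fin 4 × (Fin 3 → Bool)),
      ∃ t ≤ T, (f t).stack.length = ℓ ∧ (∀ r, t < r → r ≤ T → ℓ < (f r).stack.length) ∧
        (f t).profile = p.1 ∧
        ((∃ s, T ≤ s ∧ s ≤ N ∧ (f s).stack.length = ℓ ∧
          (∀ r, T ≤ r → r < s → ℓ < (f r).stack.length) ∧ p.2 = some (f s).profile) ∨
        (p.2 = none ∧ ∀ r, T ≤ r → r ≤ N → ℓ < (f r).stack.length)) := by
    intro ℓ
    have hℓ : (ℓ : ℕ) ≤ (f T).stack.length := by omega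
    obtain ⟨t, h1, h2, h3⟩ := exists_last_at_height (h := fun t => (f t).stack.length)
      (by simp [h.stack_zero]) (fun t ht => (h.step t (by omega)).length_le) hℓ
    rcases exists_first_at_height (h := fun t => (f t).stack.length) hT
      (fun t ht => (h.step t ht).le_length) hℓ with ⟨s, h4, h5, h6, h7⟩ | h4
    · exact ⟨((f t).profile, some (f s).profile), t, h1, h2, h3, rfl,
        .inl ⟨s, h4, h5, h6, h7, rfl⟩⟩
    · exact ⟨((f t).profile, none), t, h1, h2, h3, rfl, .inr ⟨rfl, h4⟩⟩
  choose p hp using key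
  obtain ⟨i, j, hne, hij⟩ : ∃ i j, i ≠ j ∧ p i = p j := by
    have := Fintype.ofFinite (((Q × Option G) × Fin 4 × (Fin 3 → Bool)) ×
      Option ((Q × Option G) × Fin 4 × (Fin 3 → Bool)))
    refine Fintype.exists_ne_map_eq_of_card_lt p ?_
    rw [← Nat.card_eq_fintype_card, Fintype.card_fin, ← hK]
    omega
  wlog hlt' : i < j generalizing i j
  · exact this j i hne.symm hij.symm (by omega)
  have hlt' : (i : ℕ) < j := hlt'
  obtain ⟨t₁, a1, a2, a3, a4, a5⟩ := hp i
  obtain ⟨t₂, b1, b2, b3, b4, b5⟩ := hp j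
  have h12 : t₁ < t₂ := by
    by_contra! hle
    rcases hle.eq_or_lt with heq | hlt
    · subst heq; omega
    · have := b3 t₁ hlt a1
      omega
  obtain ⟨q12, γ12, z12, e12⟩ := SlotConf.profile_eq (a4.trans (hij ▸ b4.symm))
    (h.zone_lt (by omega)).1 (h.zone_lt (by omega)).1
  have pot12 := h.potential_eq h12.le (by omega) fun r g1 g2 => by
    have := a3 (r + 1) (by omega) (by omega)
    omega
  have one12 := h.count_one_eq h12.le (by omega) e12
  rcases a5 with ⟨s₁, a5, a6, a7, a8, a9⟩ | ⟨a5, a6⟩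
  · rcases b5 with ⟨s₂, b5, b6, b7, b8, b9⟩ | ⟨b5, -⟩
    · have h43 : s₂ < s₁ := by
        by_contra! hle
        rcases hle.eq_or_lt with heq | hlt
        · subst heq; omega
        · have := b8 s₁ a5 hlt
          omega
      have hpq : (f s₁).profile = (f s₂).profile := by
        have := a9.symm.trans ((congrArg Prod.snd hij).trans b9)
        simpa using this
      obtain ⟨q43, -, z43, e43⟩ := SlotConf.profile_eq hpq
        (h.zone_lt (by omega)).1 (h.zone_lt (by omega)).1
      have pot43 := h.potential_eq h43.le a6 fun r g1 g2 => by
        have := a8 r (by omega) (by omega)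
        omega
      have one43 := h.count_one_eq h43.le a6 fun i hi => (e43 i hi).symm
      have hge : ∀ r, t₂ ≤ r → r ≤ s₂ → (f t₂).stack.length ≤ (f r).stack.length := by
        intro r g1 g2
        rw [b2]
        rcases Nat.lt_or_ge T r with g3 | g3
        · rcases g2.eq_or_lt with rfl | g2
          · omega
          · exact (b8 r (by omega) g2).le
        · rcases g1.eq_or_lt with rfl | g1
          · omega
          · exact (b3 r g1 g3).le
      have hge' : ∀ r, t₁ ≤ r → r ≤ s₁ → (f t₁).stack.length ≤ (f r).stack.length := by
        intro r g1 g2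
        rw [a2]
        rcases Nat.lt_or_ge T r with g3 | g3
        · rcases g2.eq_or_lt with rfl | g2
          · omega
          · exact (a8 r (by omega) g2).le
        · rcases g1.eq_or_lt with rfl | g1
          · omega
          · exact (a3 r g1 g3).le
      -- A stack that never drops below its height is only built upon, so on returning to that
      -- height it is unchanged.
      have stack_eq : ∀ {s t : ℕ}, s ≤ t → t ≤ N → (f s).stack.length = (f t).stack.length →
          (∀ r, s ≤ r → r ≤ t → (f s).stack.length ≤ (f r).stack.length) →
          (f t).stack = (f s).stack := by
        intro s t g1 g2 g3 g4
        obtain ⟨α, g5, -⟩ := PDA.replay h.step g1 g2 (α := []) (β := (f s).stack) rfl g4 rfl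
        have g6 := congrArg List.length g5
        rw [List.length_append] at g6
        have : α = [] := List.length_eq_zero_iff.1 (by omega)
        simpa [this] using g5
      have hacc := PDA.slotAccepts_of_excise h.step h.accepting h.stack_zero h12.le
        (b1.trans b5) h43.le a6 q12 z12 γ12 hge
        (stack_eq (b1.trans b5) b6 (by omega) hge) q43.symm z43.symm
        (stack_eq (a1.trans a5) a6 (by omega) hge')
      have le1 := h.count_le (Nat.zero_le t₁) (by omega)
      have le2 := h.count_le h12.le (by omega)
      have le3 := h.count_le (b1.trans b5) (by omega)
      have le4 := h.count_le h43.le a6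
      have hrep := h.eq_of_accepts _ (by
        have := le1 1
        have := le2 1
        have := le3 1
        have := h.count_one
        simp only [Pi.add_apply, Pi.sub_apply]
        omega) hacc
      simp only [Pi.add_apply, Pi.sub_apply] at hrep
      have i0 := h.count_eq 0 (by simp)
      have i2 := h.count_eq 2 (by simp)
      have i3 := h.count_eq 3 (by simp)
      have := le1 0; have := le1 2; have := le1 3
      have := le2 0; have := le2 2; have := le2 3
      have := le3 0; have := le3 2; have := le3 3
      have := le4 0; have := le4 2; have := le4 3
      simp only [potential, one12, one43, a2, b2, a7, b7] at pot12 pot43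
      generalize M.sig .b = σ, M.sig .a = σ' at pot12 pot43
      -- The two parts together remove `d` letters per large slot and change the height by `(2σ +
      -- σ')d = 0`, whereas the first part alone changes it by `j - i > 0`.
      cases σ <;> cases σ' <;> simp only [Action.height] at pot12 pot43 <;> omega
    · rw [hij, b5] at a9
      simp at a9
  · rcases b5 with ⟨s₂, -, -, -, -, b9⟩ | ⟨-, b6⟩
    · rw [hij, b9] at a5
      simp at a5
    · have hacc := PDA.slotAccepts_of_excise_of_never_popped h.step h.accepting h.stack_zero
        h12.le (by omega) q12 z12 γ12 fun r g1 g2 => by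
          rw [b2]
          rcases Nat.lt_or_ge T r with g3 | g3
          · exact (b6 r g3.le g2).le
          · rcases g1.eq_or_lt with rfl | g1
            · omega
            · exact (b3 r g1 g3).le
      have heq := h.count_eq_of_excise_one h12.le (by omega) e12 hacc
      simp only [potential, heq 0 (by omega), heq 1 (by omega), heq 2 (by omega),
        heq 3 (by omega), a2, b2] at pot12
      omega

end RepRun

/-! ### The final pigeonhole argument. -/

theorem PDA.SlotStep.count_le_add_one {A Q G : Type} {M : PDA A Q G} {ret : Bool} {c : ℕ → A}
    {m : ℕ} {d e : SlotConf Q G} (h : M.SlotStep ret c m d e) (i : ℕ) :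
    d.count i ≤ e.count i + 1 := by
  cases h with
  | letter q q' γ γ' z ν s =>
    by_cases hi : i = s
    · subst hi; simp; omega
    · simp [Function.update_of_ne hi]
  | endmarker => simp

namespace RepRun

variable {Q G : Type} {M : PDA Letter Q G} {ret : Bool} {n : ℕ} {f : ℕ → SlotConf Q G} {N : ℕ}

/-- All letters `a`, except possibly one, are read. -/
theorem count_three_le (h : RepRun M ret n f N) : (f N).count 3 ≤ 1 := by
  by_contra! hlt
  obtain ⟨α, g1, g2⟩ := PDA.replay h.step (Nat.zero_le N) le_rfl (α := []) (β := []) (β' := [])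
    (by simpa using h.stack_zero) (by simp) rfl
  -- With two letters `a` left, dropping one empties no slot, so `M` would also accept with one `a`
  -- fewer.
  set μ := Function.update (f N).count 3 ((f N).count 3 - 1) with hμ
  have hsupp : ∀ i, (f N).count i = 0 ↔ μ i = 0 := by
    intro i
    by_cases hi : i = 3
    · subst hi
      simp only [hμ, Function.update_self]
      omega
    · simp [hμ, Function.update_of_ne hi]
  have g3 := g2 μ fun i hi => (hsupp i).1 hi
  have g4 : M.SlotAccepting slotLetter 4 ⟨(f N).state, α ++ [], (f N).zone, μ⟩ :=
    PDA.SlotAccepting.replay (β := []) (by rw [← g1]; exact h.accepting) rfl hsupp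
  have c0 := h.count_le (Nat.zero_le N) le_rfl 0
  have c1 := h.count_le (Nat.zero_le N) le_rfl 1
  have c2 := h.count_le (Nat.zero_le N) le_rfl 2
  have c3 := h.count_le (Nat.zero_le N) le_rfl 3
  have m0 : μ 0 = (f N).count 0 := by simp [hμ]
  have m1 : μ 1 = (f N).count 1 := by simp [hμ]
  have m2 : μ 2 = (f N).count 2 := by simp [hμ]
  have m3 : μ 3 = (f N).count 3 - 1 := by simp [hμ]
  have i0 := h.count_eq 0 (by simp)
  have i1 := h.count_one
  have i2 := h.count_eq 2 (by simp)
  have i3 := h.count_eq 3 (by simp)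
  have := h.eq_of_accepts (μ + ((f 0).count - (f N).count))
    (by simp only [Pi.add_apply, Pi.sub_apply]; omega) ⟨_, by simpa using g3, g4⟩
  simp only [Pi.add_apply, Pi.sub_apply] at this
  omega

theorem exists_not [Finite Q] [Finite G] (M : PDA Letter Q G) (ret : Bool) :
    ∃ n, 1 ≤ n ∧ ∀ f N, ¬ RepRun M ret n f N := by
  set B := Nat.card (((Q × Option G) × Fin 4 × (Fin 3 → Bool)) ×
      Option ((Q × Option G) × Fin 4 × (Fin 3 → Bool))) with hB
  have : Finite {γ : List G // γ.length ≤ B} := (List.finite_length_le G B).to_subtype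
  set C := Nat.card ({γ : List G // γ.length ≤ B} × ((Q × Option G) × Fin 4 × (Fin 3 → Bool)))
    with hC
  refine ⟨C + 1, by omega, fun f N h => ?_⟩
  have key : ∀ i : Fin (C + 1), ∃ p : {γ : List G // γ.length ≤ B} ×
      ((Q × Option G) × Fin 4 × (Fin 3 → Bool)), ∃ t ≤ N, C + 1 - (f t).count 3 = i ∧
        (f t).stack = p.1 ∧ (f t).profile = p.2 := by
    intro i
    have h3 := h.count_three_le
    -- For `n = C + 1` this is the number of letters `a` read so far. It ends at `C` or more, so
    -- each of the `C + 1` values `0, …, C` occurs.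
    obtain ⟨t, h1, h2, -⟩ := exists_last_at_height (h := fun t => C + 1 - (f t).count 3) (T := N)
      (ℓ := i) (by simp [h.count_eq])
      (fun t ht => by
        have := (h.step t ht).count_le_add_one 3
        omega)
      (by omega)
    exact ⟨(⟨(f t).stack, h.length_stack_le h1⟩, (f t).profile), t, h1, h2, rfl, rfl⟩
  choose p t ht using key
  obtain ⟨i, j, hne, hij⟩ : ∃ i j, i ≠ j ∧ p i = p j := by
    have := Fintype.ofFinite ({γ : List G // γ.length ≤ B} ×
      ((Q × Option G) × Fin 4 × (Fin 3 → Bool)))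
    refine Fintype.exists_ne_map_eq_of_card_lt p ?_
    rw [← Nat.card_eq_fintype_card, Fintype.card_fin, ← hC]
    omega
  wlog hle : t i ≤ t j generalizing i j
  · exact this j i hne.symm hij.symm (by omega)
  obtain ⟨a1, a2, a3, a4⟩ := ht i
  obtain ⟨b1, b2, b3, b4⟩ := ht j
  have hstack : (f (t i)).stack = (f (t j)).stack := by rw [a3, b3, hij]
  obtain ⟨hq, hγ, hz, he⟩ := SlotConf.profile_eq (d := f (t i)) (e := f (t j))
    (by rw [a4, b4, hij]) (h.zone_lt a1).1 (h.zone_lt b1).1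
  -- The whole stack recurs, so a single part is cut out; the middle and the second part are empty.
  have hacc := PDA.slotAccepts_of_excise h.step h.accepting h.stack_zero hle le_rfl le_rfl b1
    hq hz hγ (fun r h1 h2 => by rw [le_antisymm h2 h1]) rfl rfl rfl hstack.symm
  rw [tsub_self, add_zero] at hacc
  have := h.count_eq_of_excise_one hle b1 he hacc 3 (by omega)
  exact hne (Fin.ext (by omega))

end RepRun

theorem not_headAccepts_iff_mem_Lrep {Q G : Type} [Finite Q] [Finite G] (M : PDA Letter Q G)
    (ret : Bool) : ¬ ∀ w, M.HeadAccepts ret ⟨[], M.q₀, w, []⟩ ↔ w ∈ Lrep := by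
  intro hM
  have hslot : ∀ ν, M.SlotAccepts ret slotLetter 4 ⟨M.q₀, [], 0, ν⟩ ↔
      slotWord slotLetter ν 0 4 ∈ Lrep := by
    intro ν
    rw [← PDA.headAccepts_toHeadConf_iff (by simp [SlotConf.Valid]), ← hM]
    simp [SlotConf.toHeadConf]
  obtain ⟨n, hn, hrun⟩ := RepRun.exists_not M ret
  have hone : (fun s => if s = 1 then 1 else n : ℕ → ℕ) 1 = 1 := rfl
  obtain ⟨e, h1, h2⟩ := (hslot fun s => if s = 1 then 1 else n).2
    ((slotWord_mem_Lrep_iff hone).2 ⟨hn, rfl, rfl⟩)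
  obtain ⟨f, N, h3, rfl, h4⟩ := exists_nat_chain h1
  refine hrun f N ⟨by rw [h3], by rw [h3], by rw [h3]; rfl, fun s hs => by rw [h3]; simp [hs], h4,
    h2, fun ν hν hacc => ?_⟩
  rw [h3] at hacc
  exact ((slotWord_mem_Lrep_iff hν).1 ((hslot ν).1 hacc)).2

theorem Lrep_notMem_NIDPDAwtl : Lrep ∉ NIDPDAwtl Letter := by
  rintro ⟨Q, G, _, _, M, hM⟩
  exact not_headAccepts_iff_mem_Lrep M true fun w => by rw [← hM, M.mem_retLanguage_iff]

theorem Lrep_notMem_NrNIDPDAwtl : Lrep ∉ NrNIDPDAwtl Letter := by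
  rintro ⟨Q, G, _, _, M, hM⟩
  exact not_headAccepts_iff_mem_Lrep M false fun w => by rw [← hM, M.mem_nonretLanguage_iff]

end TransPDA

theorem theorem5 :
    (TransPDA.Lrepᶜ ∈ TransPDA.NIDPDAwtl TransPDA.Letter ∧
      TransPDA.Lrepᶜ ∈ TransPDA.NrNIDPDAwtl TransPDA.Letter) ∧
    (TransPDA.Lrep ∉ TransPDA.NIDPDAwtl TransPDA.Letter ∧
      TransPDA.Lrep ∉ TransPDA.NrNIDPDAwtl TransPDA.Letter) ∧
    (¬ TransPDA.ClosedUnderComplement TransPDA.NrNIDPDAwtl ∧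
      ¬ TransPDA.ClosedUnderComplement TransPDA.NIDPDAwtl) := by
  refine ⟨⟨TransPDA.compl_Lrep_mem_NIDPDAwtl, TransPDA.compl_Lrep_mem_NrNIDPDAwtl⟩,
    ⟨TransPDA.Lrep_notMem_NIDPDAwtl, TransPDA.Lrep_notMem_NrNIDPDAwtl⟩,
    fun h => TransPDA.Lrep_notMem_NrNIDPDAwtl ?_, fun h => TransPDA.Lrep_notMem_NIDPDAwtl ?_⟩
  · simpa using h TransPDA.Letter _ TransPDA.compl_Lrep_mem_NrNIDPDAwtl
  · simpa using h TransPDA.Letter _ TransPDA.compl_Lrep_mem_NIDPDAwtl
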